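/- Let $\alpha=\tfrac12$, let $\beta>0$ with $2\beta\in\mathbb N$, and let $\Omega=[0,\alpha)\cup[\alpha+\beta,1+\beta)$ and $g=\chi_\Omega$. For $\lambda=(t,\nu)\in\mathbb R^2$ put $g_\lambda(x)=g(x-t)e^{2\pi i x\nu}$. Let $\Lambda\subseteq\mathbb R^2$ be such that the Gabor system $\{g_\lambda\}_{\lambda\in\Lambda}$ is an orthonormal basis of $L^2(\mathbb R)$. Then $\Lambda$ is $\Omega$-standard, that is, $\Lambda=\bigcup_{t\in J}\{t\}\times\Lambda_t$ where the translates $\Omega+t$, $t\in J$, are pairwise disjoint with union $\mathbb R$, and for every $t\in J$ the exponentials $\{e^{2\pi i\nu x}\}_{\nu\in\Lambda_t}$ form an orthonormal basis of $L^2(\Omega+t)$. More explicitly, there are $s\in\mathbb R$, with $s=0$ if $(0,0)\in\Lambda$, a set $K\subseteq\mathbb Z$, and for every $k\in K$ a set $L_k\subseteq\mathbb Z$ and a number $a_k\in[0,1)$, such that $$\Lambda=\bigcup_{k\in K}\Big\{s+\frac k2\Big\}\times\Big(\frac{L_k+a_k}{2\beta+1}\Big),$$ where * $K\cup\big((2\beta+1)+K\big)=\mathbb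 Z$, and this union is disjoint; * for every $k\in K$, $L_k+\{2n:\ n\in\mathbb Z,\ |n|\le 2\beta\}=\mathbb Z$ as a sum of sets; and moreover every integer is in exactly one way a sum $l+2n$ with $l\in L_k$ and $n\in\{0,1,\dots,2\beta\}$. -/

import Mathlib

open MeasureTheory
open scoped ENNReal Pointwise

noncomputable section

/-- The functions `f i` (taken modulo `μ`-a.e. equality) form an orthonormal basis of the complex
Hilbert space `L²(μ)`. The index `i` is part of the data, so distinct indices must give
orthogonal functions. -/
def IsOrthonormalBasisL2 {ι : Type*} (μ : Measure ℝ) (f : ι → ℝ → ℂ) : Prop :=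
  ∃ b : HilbertBasis ι ℂ (Lp ℂ 2 μ), ∀ i, (b i : ℝ → ℂ) =ᵐ[μ] f i

/-- The character `x ↦ e^{2 π i ν x}`. -/
def expChar (ν : ℝ) (x : ℝ) : ℂ :=
  Complex.exp (2 * (Real.pi : ℂ) * Complex.I * (x : ℂ) * (ν : ℂ))

/-- The time-frequency shift `g_λ(x) = g(x - t) e^{2 π i x ν}` for `λ = (t, ν)`. -/
def timeFreqShift (g : ℝ → ℂ) (p : ℝ × ℝ) (x : ℝ) : ℂ :=
  g (x - p.1) * expChar p.2 x

/-- The Gabor system `{g_λ}_{λ ∈ Λ}` is an orthonormal basis of `L²(ℝ)`. -/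
def IsGaborONB (g : ℝ → ℂ) (Λ : Set (ℝ × ℝ)) : Prop :=
  IsOrthonormalBasisL2 volume (fun p : Λ => timeFreqShift g (p : ℝ × ℝ))

/-- The set `Ω = [0, α) ∪ [α + β, 1 + β)`. -/
def twoIntervals (α β : ℝ) : Set ℝ :=
  Set.Ico 0 α ∪ Set.Ico (α + β) (1 + β)

/-- The characteristic function of a set, with complex values. -/
def charFn (Ω : Set ℝ) : ℝ → ℂ :=
  Ω.indicator (fun _ => (1 : ℂ))

/-- The translate `Ω + t`. -/
def shiftSet (Ω : Set ℝ) (t : ℝ) : Set ℝ :=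
  (fun x => x + t) '' Ω

/-- `Λ` is `Ω`-standard: `Λ = ⋃_{t ∈ J} {t} × Λ_t`, where the translates `Ω + t`, `t ∈ J`, are
pairwise disjoint and cover the line, and for every `t ∈ J` the exponentials with frequencies
in `Λ_t` form an orthonormal basis of `L²(Ω + t)`. -/
def IsStandard (Ω : Set ℝ) (Λ : Set (ℝ × ℝ)) : Prop :=
  ∃ (J : Set ℝ) (F : ℝ → Set ℝ),
    Λ = ⋃ t ∈ J, ({t} : Set ℝ) ×ˢ F t ∧
    (⋃ t ∈ J, shiftSet Ω t) = Set.univ ∧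
    J.PairwiseDisjoint (shiftSet Ω) ∧
    ∀ t ∈ J, IsOrthonormalBasisL2 (volume.restrict (shiftSet Ω t))
      (fun ν : F t => expChar (ν : ℝ))

/-- `A + B = ℤ` as a tiling: every integer is `a + b` for exactly one pair `(a, b) ∈ A × B`. -/
def TilesInt (A B : Set ℤ) : Prop :=
  ∀ z : ℤ, ∃! p : ℤ × ℤ, p.1 ∈ A ∧ p.2 ∈ B ∧ p.1 + p.2 = z

end

/-! Put `N = 2β + 1` and use the coordinates `(2t, Nν)`. Two windows at different times overlap
either in an interval together with its translate, or in a single interval. Orthogonality then makes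
the frequency gap an odd integer (first case only), or makes its product with the scaled length of
one overlap interval a nonzero multiple of `2N`. Neither can happen between two points of the
frequency cell `[0, 1) ∪ [2, 3) ∪ ⋯ ∪ [2N - 2, 2N - 1)`. So the translates along `Λ` of the product
of time cell and frequency cell are disjoint (`ScaledOrthogonal.packing`).

In the original coordinates this product has measure one. The spectrogram of the indicator function
of `[0, 1/2)` has integral `1/2` by Plancherel, and its translates along `Λ` sum to `1/2` by
Parseval. Comparison with a packing by a set of measure one (`setLIntegral_eq_zero_of_packing`)
leaves no room for a gap, so the packing is a tiling (`scaledTiling_of_isGaborONB`).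

The rest is combinatorial. The tiling cuts every horizontal and vertical line into unit intervals,
whose end points are congruent modulo one. Hence all times or all frequencies are congruent; in the
second case orthogonality forces the times to be congruent too
(`times_congruent_of_freqs_congruent`). Windows at distinct congruent times overlap only if the
times differ by `N`, which a parity argument excludes (`time_sub_ne`). So each occurring time
carries its own tiling of the frequency line, and this is the standard structure. -/

/-! ### Tilings of the line by unit intervals -/

/-- A set of unit intervals `[a, a + 1)`, `a ∈ A`, tiling the line has all its left end points
congruent modulo one. -/
theorem unit_tiling_congruent {A : Set ℝ} (hc : ∀ x : ℝ, ∃ a ∈ A, x - a ∈ Set.Ico (0 : ℝ) 1)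
    (hu : ∀ x : ℝ, ∀ a ∈ A, ∀ b ∈ A, x - a ∈ Set.Ico (0 : ℝ) 1 → x - b ∈ Set.Ico (0 : ℝ) 1 → a = b)
    {a b : ℝ} (ha : a ∈ A) (hb : b ∈ A) : ∃ k : ℤ, b - a = k := by
  have up : ∀ a ∈ A, a + 1 ∈ A := by
    intro a ha
    -- If the interval covering `a + 1` began earlier, its left end would also lie in `[a, a + 1)`.
    obtain ⟨c, hcA, h0, h1⟩ := hc (a + 1)
    rcases eq_or_lt_of_le h0 with h | h
    · have : c = a + 1 := by linarith
      exact this ▸ hcA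
    · have := hu c c hcA a ha ⟨by linarith, by linarith⟩ ⟨by linarith, by linarith⟩
      linarith
  have down : ∀ a ∈ A, a - 1 ∈ A := by
    intro a ha
    obtain ⟨c, hcA, h0, h1⟩ := hc (a - 1)
    have := hu a (c + 1) (up c hcA) a ha ⟨by linarith, by linarith⟩ ⟨by linarith, by linarith⟩
    have : c = a - 1 := by linarith
    exact this ▸ hcA
  have all : ∀ k : ℤ, a + k ∈ A := by
    intro k
    induction k using Int.induction_on with
    | zero => simpa using ha
    | succ i ih => have := up _ ih; push_cast at this ⊢; rwa [← add_assoc]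
    | pred i ih => have := down _ ih; push_cast at this ⊢; rwa [← add_sub_assoc]
  refine ⟨⌊b - a⌋, ?_⟩
  have h1 := Int.floor_le (b - a)
  have h2 := Int.lt_floor_add_one (b - a)
  have := hu b b hb _ (all ⌊b - a⌋) ⟨by linarith, by linarith⟩ ⟨by linarith, by linarith⟩
  linarith

/-! ### Cells and packing -/

/-- Membership in `[0, 1) ∪ [N, N + 1)`. -/
def InTimeCell (N : ℕ) (x : ℝ) : Prop :=
  x ∈ Set.Ico (0 : ℝ) 1 ∨ x ∈ Set.Ico (N : ℝ) (N + 1)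

/-- Membership in `[0, 1) ∪ [2, 3) ∪ ⋯ ∪ [2N - 2, 2N - 1)`. -/
def InFreqCell (N : ℕ) (y : ℝ) : Prop :=
  ∃ j : ℕ, j < N ∧ y ∈ Set.Ico (2 * j : ℝ) (2 * j + 1)

/-- The orthogonality relations of the Gabor system in the coordinates `(2t, Nν)`. -/
structure ScaledOrthogonal (N : ℕ) (Λ : Set (ℝ × ℝ)) : Prop where
  two_le : 2 ≤ N
  near : ∀ p ∈ Λ, ∀ q ∈ Λ, p ≠ q → 0 ≤ q.1 - p.1 → q.1 - p.1 < 1 →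
    (∃ k : ℤ, q.2 - p.2 = 2 * k + 1) ∨
      ∃ k : ℤ, k ≠ 0 ∧ (q.2 - p.2) * (1 - (q.1 - p.1)) = 2 * N * k
  far : ∀ p ∈ Λ, ∀ q ∈ Λ, ∀ u : ℝ, |u| < 1 → q.1 - p.1 = N + u →
    ∃ k : ℤ, k ≠ 0 ∧ (q.2 - p.2) * (1 - |u|) = 2 * N * k

theorem le_abs_of_mul_eq {N : ℕ} {m w : ℝ} {k : ℤ} (hk : k ≠ 0) (hw0 : 0 ≤ w) (hw1 : w ≤ 1)
    (h : m * w = 2 * N * k) : 2 * (N : ℝ) ≤ |m| := by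
  have h1 : (1 : ℝ) ≤ |(k : ℝ)| := by exact_mod_cast Int.one_le_abs hk
  have h2 : |m| * w = 2 * N * |(k : ℝ)| := by
    have := congrArg abs h
    rwa [abs_mul, abs_mul, abs_of_nonneg hw0,
      abs_of_nonneg (show (0 : ℝ) ≤ 2 * N by positivity)] at this
  have h3 : |m| * w ≤ |m| := mul_le_of_le_one_right (abs_nonneg m) hw1
  have h4 : 2 * (N : ℝ) * 1 ≤ 2 * N * |(k : ℝ)| := mul_le_mul_of_nonneg_left h1 (by positivity)
  linarith

/-- Points of the blocks `[2i, 2i + 1)` and `[2j, 2j + 1)` differ by less than one from `2(i - j)`,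
and no odd integer is that close to an even one. -/
theorem InFreqCell.sub_bound {N : ℕ} {y a b : ℝ} (ha : InFreqCell N (y - a))
    (hb : InFreqCell N (y - b)) : |b - a| < 2 * N ∧ ∀ k : ℤ, b - a ≠ 2 * k + 1 := by
  obtain ⟨i, hi, hi0, hi1⟩ := ha
  obtain ⟨j, hj, hj0, hj1⟩ := hb
  have hi' : (i : ℝ) + 1 ≤ N := by exact_mod_cast hi
  have hj' : (j : ℝ) + 1 ≤ N := by exact_mod_cast hj
  have hi2 : (0 : ℝ) ≤ i := by positivity
  have hj2 : (0 : ℝ) ≤ j := by positivity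
  refine ⟨abs_lt.2 ⟨by linarith, by linarith⟩, fun k hk => ?_⟩
  have e1 : (2 * k + 1 : ℤ) < 2 * i + 1 - 2 * j := by
    have : (2 * k + 1 : ℝ) < 2 * i + 1 - 2 * j := by linarith
    exact_mod_cast this
  have e2 : (2 * i - 2 * j - 1 : ℤ) < 2 * k + 1 := by
    have : (2 * i - 2 * j - 1 : ℝ) < 2 * k + 1 := by linarith
    exact_mod_cast this
  omega

namespace ScaledOrthogonal

variable {N : ℕ} {Λ : Set (ℝ × ℝ)}

/-- The translates of the product of the time cell and the frequency cell are disjoint. -/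
theorem packing (h : ScaledOrthogonal N Λ) {p q : ℝ × ℝ} (hp : p ∈ Λ) (hq : q ∈ Λ) {x y : ℝ}
    (hpx : InTimeCell N (x - p.1)) (hpy : InFreqCell N (y - p.2))
    (hqx : InTimeCell N (x - q.1)) (hqy : InFreqCell N (y - q.2)) : p = q := by
  wlog hle : 0 ≤ q.1 - p.1 generalizing p q
  · exact (this hq hp hqx hqy hpx hpy (by linarith)).symm
  by_contra hne
  have hN : (2 : ℝ) ≤ N := by exact_mod_cast h.two_le
  obtain ⟨hb, hodd⟩ := hpy.sub_bound hqy
  have key : ∀ w : ℝ, 0 ≤ w → w ≤ 1 → ¬ ∃ k : ℤ, k ≠ 0 ∧ (q.2 - p.2) * w = 2 * N * k := by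
    rintro w hw0 hw1 ⟨k, hk, e⟩
    exact absurd (le_abs_of_mul_eq hk hw0 hw1 e) (not_le.2 hb)
  have hnear : ¬ q.1 - p.1 < 1 := by
    intro hlt
    rcases h.near p hp q hq hne hle hlt with ⟨k, hk⟩ | hk
    · exact hodd k hk
    · exact key _ (by linarith) (by linarith) hk
  -- As `q` is not earlier than `p`, the cells meet in intervals of the same kind (gap below one),
  -- or the late interval of `p` meets the early one of `q` (gap `N + u`).
  rcases hpx with ⟨h1, h2⟩ | ⟨h1, h2⟩ <;> rcases hqx with ⟨h3, h4⟩ | ⟨h3, h4⟩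
  · exact hnear (by linarith)
  · linarith
  · have hu : |q.1 - p.1 - N| < 1 := abs_lt.2 ⟨by linarith, by linarith⟩
    exact key _ (by linarith) (by linarith [abs_nonneg (q.1 - p.1 - N)])
      (h.far p hp q hq _ hu (by ring))
  · exact hnear (by linarith)

end ScaledOrthogonal

/-! ### Rows and columns of the tiling -/

/-- The orthogonality relations together with the covering property. -/
structure ScaledTiling (N : ℕ) (Λ : Set (ℝ × ℝ)) : Prop extends ScaledOrthogonal N Λ where
  cover : ∀ x y : ℝ, ∃ p ∈ Λ, InTimeCell N (x - p.1) ∧ InFreqCell N (y - p.2)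

theorem eq_of_int_mem_Ico {x : ℝ} {j m : ℤ} (hx : x = m) (h : x ∈ Set.Ico (j : ℝ) (j + 1)) :
    x = j := by
  obtain ⟨h1, h2⟩ := h
  rw [hx] at h1 h2 ⊢
  have h3 : j ≤ m := by exact_mod_cast h1
  have h4 : m < j + 1 := by exact_mod_cast h2
  have : m = j := by omega
  rw [this]

theorem InTimeCell.eq_of_int {N : ℕ} {x : ℝ} {m : ℤ} (hx : x = m) (h : InTimeCell N x) :
    x = 0 ∨ x = N := by
  rcases h with h | h
  · left; simpa using eq_of_int_mem_Ico (j := 0) hx (by simpa using h)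
  · right; simpa using eq_of_int_mem_Ico (j := N) hx (by simpa using h)

theorem InFreqCell.eq_of_int {N : ℕ} {y : ℝ} {m : ℤ} (hy : y = m) (h : InFreqCell N y) :
    ∃ j : ℕ, j < N ∧ y = 2 * j := by
  obtain ⟨j, hj, h⟩ := h
  refine ⟨j, hj, ?_⟩
  simpa using eq_of_int_mem_Ico (j := 2 * j) hy (by simpa using h)

namespace ScaledTiling

variable {N : ℕ} {Λ : Set (ℝ × ℝ)}

theorem inFreqCell_zero (h : ScaledTiling N Λ) : InFreqCell N 0 :=
  ⟨0, by have := h.two_le; omega, by simp⟩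

/-- Tiles that meet a common horizontal line have congruent times. -/
theorem row_congruent (h : ScaledTiling N Λ) {p q : ℝ × ℝ} (hp : p ∈ Λ) (hq : q ∈ Λ) {y : ℝ}
    (hpy : InFreqCell N (y - p.2)) (hqy : InFreqCell N (y - q.2)) : ∃ k : ℤ, q.1 - p.1 = k := by
  have hN : (2 : ℝ) ≤ N := by exact_mod_cast h.two_le
  refine unit_tiling_congruent
    (A := {a | ∃ r ∈ Λ, InFreqCell N (y - r.2) ∧ (a = r.1 ∨ a = r.1 + N)}) ?_ ?_
    ⟨p, hp, hpy, Or.inl rfl⟩ ⟨q, hq, hqy, Or.inl rfl⟩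
  · intro x
    obtain ⟨r, hr, hx | hx, hy⟩ := h.cover x y
    · exact ⟨r.1, ⟨r, hr, hy, Or.inl rfl⟩, hx⟩
    · exact ⟨r.1 + N, ⟨r, hr, hy, Or.inr rfl⟩, by linarith [hx.1], by linarith [hx.2]⟩
  · rintro x a ⟨r, hr, hry, ha⟩ b ⟨r', hr', hry', hb⟩ hxa hxb
    have cell : ∀ {a r : ℝ}, (a = r ∨ a = r + N) → x - a ∈ Set.Ico (0 : ℝ) 1 →
        InTimeCell N (x - r) := by
      rintro a r (rfl | rfl) ha
      · exact Or.inl ha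
      · exact Or.inr ⟨by linarith [ha.1], by linarith [ha.2]⟩
    obtain rfl := h.packing hr hr' (cell ha hxa) hry (cell hb hxb) hry'
    rcases ha with rfl | rfl <;> rcases hb with rfl | rfl
    · rfl
    · linarith [hxa.2, hxb.1]
    · linarith [hxa.1, hxb.2]
    · rfl

/-- Tiles that meet a common vertical line have congruent frequencies. -/
theorem column_congruent (h : ScaledTiling N Λ) {p q : ℝ × ℝ} (hp : p ∈ Λ) (hq : q ∈ Λ) {x : ℝ}
    (hpx : InTimeCell N (x - p.1)) (hqx : InTimeCell N (x - q.1)) : ∃ k : ℤ, q.2 - p.2 = k := by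
  have hN : 0 < N := by have := h.two_le; omega
  refine unit_tiling_congruent
    (A := {a | ∃ r ∈ Λ, InTimeCell N (x - r.1) ∧ ∃ j : ℕ, j < N ∧ a = r.2 + 2 * j}) ?_ ?_
    ⟨p, hp, hpx, 0, hN, by simp⟩ ⟨q, hq, hqx, 0, hN, by simp⟩
  · intro y
    obtain ⟨r, hr, hx, j, hj, hy⟩ := h.cover x y
    exact ⟨r.2 + 2 * j, ⟨r, hr, hx, j, hj, rfl⟩, by linarith [hy.1], by linarith [hy.2]⟩
  · rintro y a ⟨r, hr, hrx, i, hi, rfl⟩ b ⟨r', hr', hrx', j, hj, rfl⟩ hya hyb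
    obtain rfl := h.packing hr hr' (y := y) hrx
      ⟨i, hi, by linarith [hya.1], by linarith [hya.2]⟩ hrx'
      ⟨j, hj, by linarith [hyb.1], by linarith [hyb.2]⟩
    have e1 : (2 * i : ℤ) < 2 * j + 1 := by
      have : (2 * i : ℝ) < 2 * j + 1 := by linarith [hya.1, hyb.2]
      exact_mod_cast this
    have e2 : (2 * j : ℤ) < 2 * i + 1 := by
      have : (2 * j : ℝ) < 2 * i + 1 := by linarith [hya.2, hyb.1]
      exact_mod_cast this
    have : i = j := by omega
    rw [this]

theorem exists_rowClass (h : ScaledTiling N Λ) :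
    ∃ c : ℝ → ℝ, ∀ y : ℝ, ∀ r ∈ Λ, InFreqCell N (y - r.2) → Int.fract r.1 = c y := by
  choose f hf _ hfy using fun y => h.cover 0 y
  refine ⟨fun y => Int.fract (f y).1, fun y r hr hy => ?_⟩
  exact Int.fract_eq_fract.2 (h.row_congruent (hf y) hr (hfy y) hy)

/-- The blocks in the column through `p` begin at points of `p.2 + ℤ`. So a single tile covers the
whole segment from `p.2 + k` to `p.2 + k + 1`, and it fixes the class of every row there. -/
theorem rowClass_eq_of_column (h : ScaledTiling N Λ) {c : ℝ → ℝ}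
    (hc : ∀ y : ℝ, ∀ r ∈ Λ, InFreqCell N (y - r.2) → Int.fract r.1 = c y) {p : ℝ × ℝ}
    (hp : p ∈ Λ) (k : ℤ) {y : ℝ} (hy : y - (p.2 + k) ∈ Set.Ico (0 : ℝ) 1) :
    c y = c (p.2 + k) := by
  obtain ⟨r, hr, hx, hry⟩ := h.cover p.1 (p.2 + k)
  obtain ⟨m, hm⟩ := h.column_congruent hp hr (x := p.1) (Or.inl (by simp)) hx
  obtain ⟨j, hj, e⟩ := hry.eq_of_int (m := k - m) (by push_cast; linarith)
  rw [← hc _ r hr hry, ← hc y r hr ⟨j, hj, by linarith [hy.1], by linarith [hy.2]⟩]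

/-- Either all times or all frequencies are congruent modulo one. -/
theorem times_congruent_or_freqs_congruent (h : ScaledTiling N Λ) :
    (∀ p ∈ Λ, ∀ q ∈ Λ, ∃ k : ℤ, q.1 - p.1 = k) ∨ (∀ p ∈ Λ, ∀ q ∈ Λ, ∃ k : ℤ, q.2 - p.2 = k) := by
  rw [or_iff_not_imp_right]
  intro hn
  push Not at hn
  obtain ⟨p, hp, q, hq, hpq⟩ := hn
  obtain ⟨c, hc⟩ := h.exists_rowClass
  have hd0 : 0 < Int.fract (q.2 - p.2) := by
    refine lt_of_le_of_ne (Int.fract_nonneg _) (fun e => hpq ⌊q.2 - p.2⌋ ?_)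
    have := Int.floor_add_fract (q.2 - p.2)
    linarith
  have hd1 := Int.fract_lt_one (q.2 - p.2)
  have hfl := Int.floor_add_fract (q.2 - p.2)
  -- The row class is constant on the segments cut by `p.2 + ℤ` and on those cut by `q.2 + ℤ`. The
  -- two lattices are disjoint, so each segment of one bridges an end point of the other.
  have step : ∀ k : ℤ, c (p.2 + (k + 1 : ℤ)) = c (p.2 + k) := by
    intro k
    have h1 := h.rowClass_eq_of_column hc hp k (y := p.2 + k + Int.fract (q.2 - p.2))
      ⟨by linarith, by linarith⟩
    have h2 := h.rowClass_eq_of_column hc hq (k - ⌊q.2 - p.2⌋) (y := p.2 + (k + 1 : ℤ))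
      ⟨by push_cast; linarith, by push_cast; linarith⟩
    rw [h2, ← h1]
    congr 1
    push_cast
    linarith
  have all : ∀ k : ℤ, c (p.2 + k) = c p.2 := by
    intro k
    induction k using Int.induction_on with
    | zero => simp
    | succ i ih => rw [step, ih]
    | pred i ih => rw [← ih, ← step (-(i : ℤ) - 1)]; simp
  have const : ∀ y, c y = c p.2 := fun y => by
    rw [← all ⌊y - p.2⌋]
    exact h.rowClass_eq_of_column hc hp _
      ⟨by linarith [Int.floor_le (y - p.2)], by linarith [Int.lt_floor_add_one (y - p.2)]⟩
  intro r hr r' hr'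
  refine Int.fract_eq_fract.1 ?_
  rw [hc r.2 r hr (by simpa using h.inFreqCell_zero),
    hc r'.2 r' hr' (by simpa using h.inFreqCell_zero), const r.2, const r'.2]

theorem near' (h : ScaledTiling N Λ) {p q : ℝ × ℝ} (hp : p ∈ Λ) (hq : q ∈ Λ) (hne : p ≠ q)
    (hlt : |q.1 - p.1| < 1) : (∃ k : ℤ, q.2 - p.2 = 2 * k + 1) ∨
      ∃ k : ℤ, k ≠ 0 ∧ (q.2 - p.2) * (1 - |q.1 - p.1|) = 2 * N * k := by
  rcases le_total 0 (q.1 - p.1) with h0 | h0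
  · rw [abs_of_nonneg h0] at hlt ⊢
    exact h.near p hp q hq hne h0 hlt
  · rw [abs_of_nonpos h0] at hlt ⊢
    rcases h.near q hq p hp hne.symm (by linarith) (by linarith) with ⟨k, hk⟩ | ⟨k, hk, e⟩
    · exact Or.inl ⟨-k - 1, by push_cast; linarith⟩
    · exact Or.inr ⟨-k, by simpa using hk, by push_cast; linarith⟩

/-! ### Tilings with congruent frequencies -/

section IntegerFrequencies

/-- If all frequencies are congruent, then times whose frequencies differ by an even integer are
congruent. -/
theorem times_congruent_of_even (h : ScaledTiling N Λ)
    (hf : ∀ p ∈ Λ, ∀ q ∈ Λ, ∃ k : ℤ, q.2 - p.2 = k) {p q : ℝ × ℝ} (hp : p ∈ Λ) (hq : q ∈ Λ)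
    {k : ℤ} (hk : q.2 - p.2 = 2 * k) : ∃ m : ℤ, q.1 - p.1 = m := by
  obtain ⟨c, hc⟩ := h.exists_rowClass
  have hN : (2 : ℝ) ≤ N := by exact_mod_cast h.two_le
  have hN2 := h.two_le
  have step : ∀ k : ℤ, c (p.2 + 2 * (k + 1 : ℤ)) = c (p.2 + 2 * k) := by
    intro k
    by_contra hne
    -- If the class changes between two rows at distance 2, a tile `b` on the upper row has its
    -- lowest block there, and a tile `a` on the lower row its highest. Their frequency gap is then
    -- exactly `2N`. Choosing `a` over the time of `b` makes their time cells overlap.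
    obtain ⟨b, hb, -, hby⟩ := h.cover p.1 (p.2 + 2 * (k + 1 : ℤ))
    obtain ⟨a, ha, hax, hay⟩ := h.cover b.1 (p.2 + 2 * k)
    obtain ⟨mb, hmb⟩ := hf b hb p hp
    obtain ⟨ma, hma⟩ := hf a ha p hp
    obtain ⟨j, hj, ej⟩ := hby.eq_of_int (m := mb + 2 * (k + 1)) (by push_cast; linarith)
    obtain ⟨i, hi, ei⟩ := hay.eq_of_int (m := ma + 2 * k) (by push_cast; linarith)
    have hj0 : j = 0 := by
      by_contra hj0
      obtain ⟨j, rfl⟩ := Nat.exists_eq_succ_of_ne_zero hj0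
      refine hne ?_
      rw [← hc _ b hb hby, ← hc _ b hb ⟨j, by omega, ?_⟩]
      push_cast at ej ⊢
      exact ⟨by linarith, by linarith⟩
    have hi0 : i + 1 = N := by
      by_contra hi0
      refine hne ?_
      rw [← hc _ a ha hay, ← hc _ a ha ⟨i + 1, by omega, ?_⟩]
      push_cast at ei ⊢
      exact ⟨by linarith, by linarith⟩
    have hi1 : (i : ℝ) + 1 = N := by exact_mod_cast hi0
    have hab : b.2 - a.2 = 2 * N := by
      subst hj0
      push_cast at ei ej
      linarith
    have hint : ∀ m : ℤ, b.1 - a.1 ≠ m := fun m hm => hne <| by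
      rw [← hc _ a ha hay, ← hc _ b hb hby]
      exact Int.fract_eq_fract.2 ⟨m, hm⟩
    -- With frequency gap `2N`, the orthogonality relation would make `1 - u` an integer.
    have key : ∀ u : ℝ, 0 < u → u < 1 → ∀ m : ℤ, (b.2 - a.2) * (1 - |u|) ≠ 2 * N * m := by
      intro u hu0 hu1 m hm
      rw [hab, abs_of_pos hu0] at hm
      have hm' : 1 - u = m := mul_left_cancel₀ (by positivity) hm
      have h1 : (0 : ℤ) < m := by
        have : (0 : ℝ) < m := by linarith
        exact_mod_cast this
      have h2 : m < (1 : ℤ) := by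
        have : (m : ℝ) < 1 := by linarith
        exact_mod_cast this
      omega
    rcases hax with ⟨h0, h1⟩ | ⟨h0, h1⟩
    · have h0' : 0 < b.1 - a.1 := lt_of_le_of_ne h0 fun e => hint 0 (by push_cast; linarith)
      rcases h.near' ha hb (fun e => hint 0 (by simp [e]))
        (abs_lt.2 ⟨by linarith, by linarith⟩) with ⟨m, hm⟩ | ⟨m, -, hm⟩
      · have : (2 * N : ℤ) = 2 * m + 1 := by
          have : (2 * N : ℝ) = 2 * m + 1 := by linarith
          exact_mod_cast this
        omega
      · exact key _ h0' h1 m hm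
    · have h0' : 0 < b.1 - a.1 - N :=
        lt_of_le_of_ne (by linarith) fun e => hint N (by push_cast; linarith)
      obtain ⟨m, -, hm⟩ := h.far a ha b hb (b.1 - a.1 - N)
        (abs_lt.2 ⟨by linarith, by linarith⟩) (by ring)
      exact key _ h0' (by linarith) m hm
  have all : ∀ k : ℤ, c (p.2 + 2 * k) = c p.2 := by
    intro k
    induction k using Int.induction_on with
    | zero => simp
    | succ i ih => rw [step, ih]
    | pred i ih => rw [← ih, ← step (-(i : ℤ) - 1)]; simp
  refine Int.fract_eq_fract.1 ?_
  rw [hc p.2 p hp (by simpa using h.inFreqCell_zero),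
    hc q.2 q hq (by simpa using h.inFreqCell_zero), ← all k, ← hk]
  congr 1
  ring

/-- Every frequency congruent modulo `2N` to that of `p` occurs at the time of `p` or at the time
`N` earlier. -/
theorem exists_freq_shift (h : ScaledTiling N Λ)
    (hf : ∀ p ∈ Λ, ∀ q ∈ Λ, ∃ k : ℤ, q.2 - p.2 = k) {p : ℝ × ℝ} (hp : p ∈ Λ) (j : ℤ) :
    (p.1, p.2 + 2 * N * j) ∈ Λ ∨ (p.1 - N, p.2 + 2 * N * j) ∈ Λ := by
  obtain ⟨r, hr, hx, hy⟩ := h.cover p.1 (p.2 + 2 * N * j)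
  obtain ⟨m, hm⟩ := hf r hr p hp
  obtain ⟨i, hi, ei⟩ := hy.eq_of_int (m := m + 2 * N * j) (by push_cast; linarith)
  obtain ⟨t, ht⟩ := h.times_congruent_of_even hf hr hp (k := i - N * j)
    (by push_cast; linarith)
  -- The point lies at height `2i` above `r.2` with `0 ≤ i < N`, so a gap divisible by `2N` forces
  -- `i = 0`.
  have hmod : (∃ k : ℤ, p.2 - r.2 = 2 * N * k) → r.2 = p.2 + 2 * N * j := by
    rintro ⟨k, hk⟩
    have e : (i : ℤ) = N * (k + j) := by
      have : (2 * i : ℝ) = 2 * (N * (k + j)) := by linarith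
      have : (2 * i : ℤ) = 2 * (N * (k + j)) := by exact_mod_cast this
      omega
    have hz : k + j = 0 := by
      have h1 : (0 : ℤ) < N := by have := h.two_le; omega
      have h2 : (N : ℤ) * (k + j) < N * 1 := by omega
      have h3 : (N : ℤ) * (-1) < N * (k + j) := by omega
      have h4 := lt_of_mul_lt_mul_left h2 h1.le
      have h5 := lt_of_mul_lt_mul_left h3 h1.le
      omega
    have hz' : (k : ℝ) = -j := by
      have : k = -j := by omega
      rw [this]; push_cast; ring
    rw [hz'] at hk
    linarith
  rcases hx.eq_of_int ht with e | e
  · left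
    have : r = (p.1, p.2 + 2 * N * j) := by
      refine Prod.ext (by simp; linarith) (hmod ?_)
      by_cases hpr : r = p
      · exact ⟨0, by simp [hpr]⟩
      rcases h.near' hr hp hpr (by rw [e]; simp) with ⟨k, hk⟩ | ⟨k, -, hk⟩
      · have : (2 * i - 2 * N * j : ℤ) = 2 * k + 1 := by
          have : (2 * i - 2 * N * j : ℝ) = 2 * k + 1 := by linarith
          exact_mod_cast this
        have : 2 * (i - N * j : ℤ) = 2 * k + 1 := by linarith
        omega
      · exact ⟨k, by rw [← hk, e]; simp⟩
    exact this ▸ hr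
  · right
    have : r = (p.1 - N, p.2 + 2 * N * j) := by
      refine Prod.ext (by simp; linarith) (hmod ?_)
      obtain ⟨k, -, hk⟩ := h.far r hr p hp 0 (by simp) (by rw [e]; ring)
      exact ⟨k, by simpa using hk⟩
    exact this ▸ hr

/-- Two tiles whose frequencies differ by an odd integer do not have noncongruent times at distance
less than one from `N`. -/
theorem not_far_of_odd (h : ScaledTiling N Λ)
    (hf : ∀ p ∈ Λ, ∀ q ∈ Λ, ∃ k : ℤ, q.2 - p.2 = k) {p q : ℝ × ℝ} (hp : p ∈ Λ) (hq : q ∈ Λ)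
    {k : ℤ} (hk : q.2 - p.2 = 2 * k + 1) {u : ℝ} (hu : |u| < 1) (hu0 : u ≠ 0)
    (hpq : q.1 - p.1 = N + u) : False := by
  have hN : (0 : ℝ) < 2 * N := by
    have := h.two_le
    have : (2 : ℝ) ≤ N := by exact_mod_cast this
    linarith
  have hu1 := abs_pos.2 hu0
  set w := 1 - |u| with hw
  have hint : ∀ m : ℤ, w ≠ m := by
    intro m hm
    have h1 : (0 : ℝ) < m := by linarith
    have h2 : (m : ℝ) < 1 := by linarith
    have h1' : 0 < m := by exact_mod_cast h1
    have h2' : m < 1 := by exact_mod_cast h2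
    omega
  obtain ⟨m, -, hm⟩ := h.far p hp q hq u hu hpq
  -- If a shift by `2N` in frequency stayed at the same time, subtracting the two relations would
  -- make `w` an integer. So it moves to the time `N` earlier, for `p` and likewise for `q`.
  obtain hp1 : (p.1 - N, p.2 + 2 * N * (1 : ℤ)) ∈ Λ := by
    refine (h.exists_freq_shift hf hp 1).resolve_left fun hp1 => ?_
    obtain ⟨m', -, hm'⟩ := h.far _ hp1 q hq u hu hpq
    refine hint (m - m') (mul_left_cancel₀ hN.ne' ?_)
    push_cast at hm' ⊢
    linarith
  obtain hq1 : (q.1 - N, q.2 + 2 * N * (1 : ℤ)) ∈ Λ := by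
    refine (h.exists_freq_shift hf hq 1).resolve_left fun hq1 => ?_
    obtain ⟨m', -, hm'⟩ := h.far p hp _ hq1 u hu hpq
    refine hint (m' - m) (mul_left_cancel₀ hN.ne' ?_)
    push_cast at hm' ⊢
    linarith
  -- If the shift of `p` by `4N` stays at its time, then `2w` is an integer, so `w = 1/2` and the
  -- odd gap would equal `4Nm`. If it moves, two points at time `p.1 - N` with frequencies `2N`
  -- apart face the moved `q`, and again `w` is an integer.
  rcases h.exists_freq_shift hf hp 2 with hp2 | hp2
  · obtain ⟨m', -, hm'⟩ := h.far _ hp2 q hq u hu hpq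
    have h2w : 2 * w = (m - m' : ℤ) := by
      refine mul_left_cancel₀ hN.ne' ?_
      push_cast at hm' ⊢
      linarith
    have hmm : m - m' = 1 := by
      have h1 : (0 : ℝ) < (m - m' : ℤ) := by linarith
      have h2 : ((m - m' : ℤ) : ℝ) < 2 := by linarith
      have h1' : 0 < m - m' := by exact_mod_cast h1
      have h2' : m - m' < 2 := by exact_mod_cast h2
      omega
    rw [hmm] at h2w
    have hw2 : w = 1 / 2 := by push_cast at h2w; linarith
    rw [← hw, hw2, hk] at hm
    have : (2 * k + 1 : ℤ) = 2 * (2 * N * m) := by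
      have : (2 * k + 1 : ℝ) = 2 * (2 * N * m) := by linarith
      exact_mod_cast this
    omega
  · obtain ⟨m1, -, hm1⟩ := h.far _ hp1 _ hq1 u hu (by simp only; linarith)
    obtain ⟨m2, -, hm2⟩ := h.far _ hp2 _ hq1 u hu (by simp only; linarith)
    refine hint (m1 - m2) (mul_left_cancel₀ hN.ne' ?_)
    push_cast at hm1 hm2 ⊢
    linarith

/-- If all frequencies are congruent modulo one, then so are all times. -/
theorem times_congruent_of_freqs_congruent (h : ScaledTiling N Λ)
    (hf : ∀ p ∈ Λ, ∀ q ∈ Λ, ∃ k : ℤ, q.2 - p.2 = k) :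
    ∀ p ∈ Λ, ∀ q ∈ Λ, ∃ k : ℤ, q.1 - p.1 = k := by
  by_contra! hn
  obtain ⟨a, ha, b, hb, hab⟩ := hn
  have hpar : ∀ p ∈ Λ, ∀ q ∈ Λ, ∃ k : ℤ, q.2 - p.2 = 2 * k ∨ q.2 - p.2 = 2 * k + 1 := by
    intro p hp q hq
    obtain ⟨m, hm⟩ := hf p hp q hq
    rcases Int.even_or_odd' m with ⟨k, rfl | rfl⟩
    · exact ⟨k, Or.inl (by rw [hm]; push_cast; ring)⟩
    · exact ⟨k, Or.inr (by rw [hm]; push_cast; ring)⟩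
  obtain ⟨d, hd⟩ : ∃ d : ℤ, b.2 - a.2 = 2 * d + 1 := by
    obtain ⟨d, hd | hd⟩ := hpar a ha b hb
    · obtain ⟨m, hm⟩ := h.times_congruent_of_even hf ha hb hd
      exact absurd hm (hab m)
    · exact ⟨d, hd⟩
  -- Each parity class of frequencies has one class of times, and the classes of `a` and `b` are
  -- distinct.
  have hodd : ∀ p ∈ Λ, ∀ q ∈ Λ, ∀ k : ℤ, q.2 - p.2 = 2 * k + 1 → ∀ m : ℤ, q.1 - p.1 ≠ m := by
    intro p hp q hq k hk m hm
    obtain ⟨i, hi | hi⟩ := hpar a ha p hp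
    · obtain ⟨m1, hm1⟩ := h.times_congruent_of_even hf ha hp hi
      obtain ⟨m2, hm2⟩ := h.times_congruent_of_even hf hb hq (k := i + k - d)
        (by push_cast; linarith)
      exact hab (m1 + m - m2) (by push_cast; linarith)
    · obtain ⟨m1, hm1⟩ := h.times_congruent_of_even hf hb hp (k := i - d)
        (by push_cast; linarith)
      obtain ⟨m2, hm2⟩ := h.times_congruent_of_even hf ha hq (k := i + k + 1)
        (by push_cast; linarith)
      exact hab (m2 - m - m1) (by push_cast; linarith)
  -- The tile covering the point one unit above the corner of `p` has the other parity;
  -- `not_far_of_odd` excludes its late interval. Two such steps go back by an integer in `(0, 2)`,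
  -- hence by exactly one.
  have prev : ∀ p ∈ Λ, ∃ q ∈ Λ, 0 < p.1 - q.1 ∧ p.1 - q.1 < 1 ∧
      ∃ k : ℤ, q.2 - p.2 = 2 * k + 1 := by
    intro p hp
    obtain ⟨q, hq, hx, hy⟩ := h.cover p.1 (p.2 + 1)
    obtain ⟨m, hm⟩ := hf q hq p hp
    obtain ⟨j, -, ej⟩ := hy.eq_of_int (m := m + 1) (by push_cast; linarith)
    have hqp : q.2 - p.2 = 2 * (-j : ℤ) + 1 := by push_cast; linarith
    have hpq : p.2 - q.2 = 2 * (j - 1 : ℤ) + 1 := by push_cast; linarith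
    have hni := hodd q hq p hp _ hpq
    rcases hx with ⟨h0, h1⟩ | ⟨h0, h1⟩
    · exact ⟨q, hq, lt_of_le_of_ne h0 fun e => hni 0 (by push_cast; linarith), h1, _, hqp⟩
    · exfalso
      exact h.not_far_of_odd hf hq hp hpq (u := p.1 - q.1 - N)
        (abs_lt.2 ⟨by linarith, by linarith⟩)
        (fun e => hni N (by push_cast; linarith)) (by ring)
  have pred : ∀ p ∈ Λ, ∃ q ∈ Λ, q.1 = p.1 - 1 ∧ ∃ k : ℤ, q.2 - p.2 = 2 * k := by
    intro p hp
    obtain ⟨q, hq, h0, h1, k, hk⟩ := prev p hp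
    obtain ⟨r, hr, h2, h3, l, hl⟩ := prev q hq
    have hrp : r.2 - p.2 = 2 * (k + l + 1 : ℤ) := by push_cast; linarith
    obtain ⟨m, hm⟩ := h.times_congruent_of_even hf hp hr hrp
    refine ⟨r, hr, ?_, _, hrp⟩
    have h4 : (-2 : ℝ) < m := by linarith
    have h5 : (m : ℝ) < 0 := by linarith
    have h4' : -2 < m := by exact_mod_cast h4
    have h5' : m < 0 := by exact_mod_cast h5
    have : m = -1 := by omega
    rw [this] at hm
    push_cast at hm
    linarith
  have iter : ∀ n : ℕ, ∃ q ∈ Λ, q.1 = a.1 - n ∧ ∃ k : ℤ, q.2 - a.2 = 2 * k := by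
    intro n
    induction n with
    | zero => exact ⟨a, ha, by simp, 0, by simp⟩
    | succ n ih =>
      obtain ⟨q, hq, e, k, hk⟩ := ih
      obtain ⟨r, hr, e', l, hl⟩ := pred q hq
      exact ⟨r, hr, by push_cast; linarith, k + l, by push_cast; linarith⟩
  -- Now `p` is exactly `N` before `a` with the same parity, and `q` is less than one before `a`
  -- with the other parity: the configuration excluded by `not_far_of_odd`.
  obtain ⟨p, hp, e, k, hk⟩ := iter N
  obtain ⟨q, hq, h0, h1, l, hl⟩ := prev a ha
  exact h.not_far_of_odd hf hp hq (k := l - k) (by push_cast; linarith) (u := q.1 - a.1)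
    (abs_lt.2 ⟨by linarith, by linarith⟩) (fun e => by linarith) (by linarith)

end IntegerFrequencies

/-! ### Separation of the times -/

/-- All times are congruent modulo one. -/
theorem times_congruent (h : ScaledTiling N Λ) :
    ∀ p ∈ Λ, ∀ q ∈ Λ, ∃ k : ℤ, q.1 - p.1 = k :=
  h.times_congruent_or_freqs_congruent.elim id h.times_congruent_of_freqs_congruent

/-- No two times differ by `N`. -/
theorem time_sub_ne (h : ScaledTiling N Λ) {p q : ℝ × ℝ} (hp : p ∈ Λ) (hq : q ∈ Λ) :
    q.1 - p.1 ≠ N := by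
  intro hpq
  have hcell0 : InTimeCell N (q.1 - q.1) := Or.inl (by simp)
  -- The covering tile `r` has an odd frequency gap to `q`. Its time is that of `q` or that of `p`,
  -- and the relation at distance exactly `N` makes this gap a multiple of `2N`.
  obtain ⟨r, hr, hx, hy⟩ := h.cover q.1 (q.2 + 1)
  obtain ⟨m, hm⟩ := h.column_congruent hr hq hx hcell0
  obtain ⟨j, -, ej⟩ := hy.eq_of_int (m := m + 1) (by push_cast; linarith)
  obtain ⟨t, ht⟩ := h.times_congruent r hr q hq
  obtain ⟨k, -, hk⟩ := h.far p hp q hq 0 (by simp) (by linarith)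
  rcases hx.eq_of_int ht with e | e
  · obtain ⟨l, -, hl⟩ := h.far p hp r hr 0 (by simp) (by linarith)
    have : (1 : ℤ) = 2 * (j + N * l - N * k) := by
      have : (1 : ℝ) = 2 * (j + N * l - N * k) := by
        simp only [abs_zero, sub_zero, mul_one] at hk hl
        linarith
      exact_mod_cast this
    omega
  · obtain ⟨l, -, hl⟩ := h.far r hr q hq 0 (by simp) (by linarith)
    have : (1 : ℤ) = 2 * (j - N * l) := by
      have : (1 : ℝ) = 2 * (j - N * l) := by
        simp only [abs_zero, sub_zero, mul_one] at hl
        linarith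
      exact_mod_cast this
    omega

/-- A point above a time that occurs is covered by a tile at that time. -/
theorem exists_at_time (h : ScaledTiling N Λ) {p : ℝ × ℝ} (hp : p ∈ Λ) (y : ℝ) :
    ∃ r ∈ Λ, r.1 = p.1 ∧ InFreqCell N (y - r.2) := by
  obtain ⟨r, hr, hx, hy⟩ := h.cover p.1 y
  obtain ⟨t, ht⟩ := h.times_congruent r hr p hp
  rcases hx.eq_of_int ht with e | e
  · exact ⟨r, hr, by linarith, hy⟩
  · exact absurd e (h.time_sub_ne hr hp)

end ScaledTiling

/-! ### Characters and their integrals -/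

theorem expChar_add_right (ν x y : ℝ) : expChar ν (x + y) = expChar ν x * expChar ν y := by
  rw [expChar, expChar, expChar, ← Complex.exp_add]
  congr 1
  push_cast
  ring

theorem expChar_mul_conj (ν μ x : ℝ) :
    expChar ν x * (starRingEnd ℂ) (expChar μ x) = expChar (ν - μ) x := by
  rw [expChar, expChar, expChar, ← Complex.exp_conj, ← Complex.exp_add]
  congr 1
  simp only [map_mul, Complex.conj_ofReal, Complex.conj_I, map_ofNat]
  push_cast
  ring

theorem norm_expChar (ν x : ℝ) : ‖expChar ν x‖ = 1 := by
  have : expChar ν x = Complex.exp (((2 * Real.pi * x * ν : ℝ) : ℂ) * Complex.I) := by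
    rw [expChar]
    congr 1
    push_cast
    ring
  rw [this, Complex.norm_exp_ofReal_mul_I]

@[fun_prop]
theorem continuous_expChar (ν : ℝ) : Continuous (expChar ν) := by
  unfold expChar
  fun_prop

theorem expChar_zero_left (x : ℝ) : expChar 0 x = 1 := by simp [expChar]

theorem expChar_eq_one_iff {ν x : ℝ} : expChar ν x = 1 ↔ ∃ k : ℤ, ν * x = k := by
  rw [expChar, Complex.exp_eq_one_iff]
  refine exists_congr fun k => ?_
  have hpi : (2 * (Real.pi : ℂ) * Complex.I) ≠ 0 := Complex.two_pi_I_ne_zero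
  constructor
  · intro h
    have : (2 * (Real.pi : ℂ) * Complex.I) * (ν * x : ℝ) = (2 * (Real.pi : ℂ) * Complex.I) * k := by
      push_cast
      linear_combination h
    exact_mod_cast mul_left_cancel₀ hpi this
  · intro h
    have : ((ν * x : ℝ) : ℂ) = k := by rw [h]; simp
    push_cast at this
    linear_combination (2 * (Real.pi : ℂ) * Complex.I) * this

theorem expChar_eq_neg_one {ν x : ℝ} (h : expChar ν x = -1) : ∃ k : ℤ, 2 * (ν * x) = 2 * k + 1 := by
  have h2 : expChar ν (x + x) = 1 := by rw [expChar_add_right, h]; norm_num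
  obtain ⟨m, hm⟩ := expChar_eq_one_iff.1 h2
  rcases Int.even_or_odd' m with ⟨k, rfl | rfl⟩
  · have : expChar ν x = 1 := expChar_eq_one_iff.2 ⟨k, by push_cast at hm; linarith⟩
    rw [this] at h
    norm_num at h
  · exact ⟨k, by push_cast at hm; linarith⟩

/-- The integral of a character over an interval vanishes iff the interval holds a nonzero whole
number of periods. -/
theorem integral_expChar_Ico_eq_zero_iff {ν a b : ℝ} (hab : a < b) :
    ∫ x in Set.Ico a b, expChar ν x = 0 ↔ ∃ k : ℤ, k ≠ 0 ∧ ν * (b - a) = k := by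
  rcases eq_or_ne ν 0 with rfl | hν
  · have : ((b - a : ℝ) : ℂ) ≠ 0 := by
      rw [Complex.ofReal_ne_zero]
      linarith
    have h1 : ∫ x in Set.Ico a b, expChar 0 x = ((b - a : ℝ) : ℂ) := by
      simp [expChar_zero_left, hab.le]
    rw [h1]
    refine ⟨fun h => absurd h this, ?_⟩
    rintro ⟨k, hk, e⟩
    rw [zero_mul] at e
    exact absurd (by exact_mod_cast e.symm) hk
  · have hc : (2 * (Real.pi : ℂ) * Complex.I * ν) ≠ 0 :=
      mul_ne_zero Complex.two_pi_I_ne_zero (by exact_mod_cast hν)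
    have h1 : ∫ x in Set.Ico a b, expChar ν x =
        expChar ν a * (expChar ν (b - a) - 1) / (2 * (Real.pi : ℂ) * Complex.I * ν) := by
      rw [integral_Ico_eq_integral_Ioc, ← intervalIntegral.integral_of_le hab.le,
        mul_sub, ← expChar_add_right, mul_one, add_sub_cancel]
      have e : ∀ x : ℝ, expChar ν x = Complex.exp (2 * (Real.pi : ℂ) * Complex.I * ν * x) :=
        fun x => by rw [expChar]; ring_nf
      simp_rw [e]
      exact integral_exp_mul_complex hc
    have h2 : expChar ν a ≠ 0 := by
      rw [← norm_ne_zero_iff, norm_expChar]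
      exact one_ne_zero
    rw [h1, div_eq_zero_iff, or_iff_left hc, mul_eq_zero, or_iff_right h2, sub_eq_zero,
      expChar_eq_one_iff]
    refine exists_congr fun k => ⟨fun h => ⟨?_, h⟩, fun h => h.2⟩
    rintro rfl
    have := mul_ne_zero hν (sub_ne_zero.2 hab.ne')
    exact this (by simpa using h)

/-! ### Orthogonality relations of the Gabor system -/

/-- The set `[0, 1/2) ∪ [N/2, (N+1)/2)`. -/
def halfIntervals (N : ℕ) : Set ℝ :=
  Set.Ico 0 (1 / 2) ∪ Set.Ico ((N : ℝ) / 2) ((N + 1) / 2)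

theorem mem_halfIntervals_iff {N : ℕ} {x : ℝ} : x ∈ halfIntervals N ↔ InTimeCell N (2 * x) := by
  unfold halfIntervals InTimeCell
  simp only [Set.mem_union, Set.mem_Ico]
  refine or_congr (and_congr ?_ ?_) (and_congr ?_ ?_) <;> constructor <;> intro h <;> linarith

theorem measurableSet_halfIntervals (N : ℕ) : MeasurableSet (halfIntervals N) :=
  measurableSet_Ico.union measurableSet_Ico

theorem volume_halfIntervals {N : ℕ} (hN : 1 ≤ N) : volume (halfIntervals N) = 1 := by
  have hN' : (1 : ℝ) ≤ N := by exact_mod_cast hN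
  rw [halfIntervals, measure_union _ measurableSet_Ico, Real.volume_Ico, Real.volume_Ico,
    ← ENNReal.ofReal_add (by norm_num) (by linarith), ← ENNReal.ofReal_one]
  · congr 1
    ring
  · rw [Set.disjoint_left]
    rintro x ⟨-, h⟩ ⟨h', -⟩
    linarith

/-- The `L²` inner product of two time-frequency shifts of indicator functions. -/
theorem timeFreqShift_mul_conj (A B : Set ℝ) (p q : ℝ × ℝ) (x : ℝ) :
    timeFreqShift (charFn A) q x * (starRingEnd ℂ) (timeFreqShift (charFn B) p x) =
      {x | x - p.1 ∈ B ∧ x - q.1 ∈ A}.indicator (expChar (q.2 - p.2)) x := by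
  by_cases hB : x - p.1 ∈ B <;> by_cases hA : x - q.1 ∈ A <;>
    simp [timeFreqShift, charFn, hA, hB, expChar_mul_conj]

theorem measurableSet_sub_mem {A : Set ℝ} (hA : MeasurableSet A) (t : ℝ) :
    MeasurableSet {x : ℝ | x - t ∈ A} :=
  (measurable_id.sub_const t) hA

theorem inner_eq_setIntegral {A B : Set ℝ} (hA : MeasurableSet A) (hB : MeasurableSet B)
    {p q : ℝ × ℝ} {f g : Lp ℂ 2 (volume : Measure ℝ)}
    (hf : (f : ℝ → ℂ) =ᵐ[volume] timeFreqShift (charFn B) p)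
    (hg : (g : ℝ → ℂ) =ᵐ[volume] timeFreqShift (charFn A) q) :
    inner ℂ f g = ∫ x in {x | x - p.1 ∈ B ∧ x - q.1 ∈ A}, expChar (q.2 - p.2) x := by
  have hm : MeasurableSet {x : ℝ | x - p.1 ∈ B ∧ x - q.1 ∈ A} :=
    (measurableSet_sub_mem hB p.1).inter (measurableSet_sub_mem hA q.1)
  rw [L2.inner_def, ← integral_indicator hm]
  refine integral_congr_ae ?_
  filter_upwards [hf, hg] with x hfx hgx
  rw [hfx, hgx, RCLike.inner_apply, timeFreqShift_mul_conj]

theorem setIntegral_expChar_translate {S T : Set ℝ} (ν c : ℝ)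
    (h : ∀ u, u + c ∈ T ↔ u ∈ S) :
    ∫ x in T, expChar ν x = expChar ν c * ∫ x in S, expChar ν x := by
  have hS : S = (fun u : ℝ => u + c) ⁻¹' T := Set.ext fun u => (h u).symm
  have e := (measurePreserving_add_right (volume : Measure ℝ) c).setIntegral_preimage_emb
    (measurableEmbedding_addRight c) (expChar ν) T
  rw [← e, ← hS, ← integral_const_mul]
  exact integral_congr_ae (Filter.Eventually.of_forall fun u => by
    simp only [expChar_add_right, mul_comm])

/-- The overlap is an interval and its translate by `N/2`, so with `ν = q.2 - p.2` the integral is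
`1 + e^{πiNν}` times the integral over one interval. The two alternatives are the zeros of the two
factors. -/
theorem integral_overlap_near {N : ℕ} (hN : 2 ≤ N) {p q : ℝ × ℝ} (h0 : 0 ≤ q.1 - p.1)
    (h1 : q.1 - p.1 < 1 / 2)
    (hz : ∫ x in {x | x - p.1 ∈ halfIntervals N ∧ x - q.1 ∈ halfIntervals N},
      expChar (q.2 - p.2) x = 0) :
    (∃ k : ℤ, N * (q.2 - p.2) = 2 * k + 1) ∨
      ∃ k : ℤ, k ≠ 0 ∧ (q.2 - p.2) * (1 / 2 - (q.1 - p.1)) = k := by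
  have hN' : (2 : ℝ) ≤ N := by exact_mod_cast hN
  have hset : {x | x - p.1 ∈ halfIntervals N ∧ x - q.1 ∈ halfIntervals N} =
      Set.Ico q.1 (p.1 + 1 / 2) ∪ Set.Ico (q.1 + N / 2) (p.1 + 1 / 2 + N / 2) := by
    ext x
    simp only [halfIntervals, Set.mem_ofPred_eq, Set.mem_union, Set.mem_Ico]
    constructor
    · rintro ⟨⟨h2, h3⟩ | ⟨h2, h3⟩, ⟨h4, h5⟩ | ⟨h4, h5⟩⟩
      · exact Or.inl ⟨by linarith, by linarith⟩
      · linarith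
      · linarith
      · exact Or.inr ⟨by linarith, by linarith⟩
    · rintro (⟨h2, h3⟩ | ⟨h2, h3⟩)
      · exact ⟨Or.inl ⟨by linarith, by linarith⟩, Or.inl ⟨by linarith, by linarith⟩⟩
      · exact ⟨Or.inr ⟨by linarith, by linarith⟩, Or.inr ⟨by linarith, by linarith⟩⟩
  have hint : ∀ a b : ℝ, IntegrableOn (expChar (q.2 - p.2)) (Set.Ico a b) := fun a b =>
    ((continuous_expChar _).continuousOn.integrableOn_Icc).mono_set Set.Ico_subset_Icc_self
  rw [hset, setIntegral_union _ measurableSet_Ico (hint _ _) (hint _ _),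
    setIntegral_expChar_translate (S := Set.Ico q.1 (p.1 + 1 / 2))
      (T := Set.Ico (q.1 + N / 2) (p.1 + 1 / 2 + N / 2)) (q.2 - p.2) ((N : ℝ) / 2)
      (fun u => by simp only [Set.mem_Ico]; constructor <;> rintro ⟨_, _⟩ <;> constructor <;>
                    linarith)] at hz
  · have hz' : (expChar (q.2 - p.2) ((N : ℝ) / 2) + 1) *
        ∫ x in Set.Ico q.1 (p.1 + 1 / 2), expChar (q.2 - p.2) x = 0 := by
      linear_combination hz
    rcases mul_eq_zero.1 hz' with h | h
    · obtain ⟨k, hk⟩ := expChar_eq_neg_one (eq_neg_of_add_eq_zero_left h)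
      exact Or.inl ⟨k, by linarith⟩
    · obtain ⟨k, hk, e⟩ := (integral_expChar_Ico_eq_zero_iff (by linarith)).1 h
      exact Or.inr ⟨k, hk, by rw [← e]; ring⟩
  · rw [Set.disjoint_left]
    rintro x ⟨h2, h3⟩ ⟨h4, h5⟩
    linarith

/-- Only the late interval of `p` meets the early one of `q`, in a single interval of length `(1 -
|u|) / 2`. -/
theorem integral_overlap_far {N : ℕ} (hN : 2 ≤ N) {p q : ℝ × ℝ} {u : ℝ} (hu : |u| < 1)
    (h : q.1 - p.1 = (N + u) / 2)
    (hz : ∫ x in {x | x - p.1 ∈ halfIntervals N ∧ x - q.1 ∈ halfIntervals N},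
      expChar (q.2 - p.2) x = 0) :
    ∃ k : ℤ, k ≠ 0 ∧ (q.2 - p.2) * ((1 - |u|) / 2) = k := by
  have hN' : (2 : ℝ) ≤ N := by exact_mod_cast hN
  obtain ⟨hu1, hu2⟩ := abs_lt.1 hu
  have hset : {x | x - p.1 ∈ halfIntervals N ∧ x - q.1 ∈ halfIntervals N} =
      Set.Ico (max (p.1 + N / 2) q.1) (min (p.1 + (N + 1) / 2) (q.1 + 1 / 2)) := by
    ext x
    simp only [halfIntervals, Set.mem_ofPred_eq, Set.mem_union, Set.mem_Ico, max_le_iff,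
      lt_min_iff]
    constructor
    · rintro ⟨⟨h2, h3⟩ | ⟨h2, h3⟩, ⟨h4, h5⟩ | ⟨h4, h5⟩⟩
      · linarith
      · linarith
      · exact ⟨⟨by linarith, by linarith⟩, by linarith, by linarith⟩
      · linarith
    · rintro ⟨⟨h2, h3⟩, h4, h5⟩
      exact ⟨Or.inr ⟨by linarith, by linarith⟩, Or.inl ⟨by linarith, by linarith⟩⟩
  have hlen : min (p.1 + (N + 1) / 2) (q.1 + 1 / 2) - max (p.1 + N / 2) q.1 = (1 - |u|) / 2 := by
    have hq : q.1 = p.1 + (N + u) / 2 := by linarith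
    rcases le_total 0 u with h0 | h0
    · rw [abs_of_nonneg h0, min_eq_left (by linarith), max_eq_right (by linarith), hq]
      ring
    · rw [abs_of_nonpos h0, min_eq_right (by linarith), max_eq_left (by linarith), hq]
      ring
  rw [hset] at hz
  rw [← hlen]
  exact (integral_expChar_Ico_eq_zero_iff (by linarith)).1 hz

/-- The set `Λ` in the coordinates `(2t, Nν)`. -/
def scaleSet (N : ℕ) (Λ : Set (ℝ × ℝ)) : Set (ℝ × ℝ) :=
  (fun p : ℝ × ℝ => (2 * p.1, N * p.2)) '' Λ

theorem scaledOrthogonal_of_isGaborONB {N : ℕ} (hN : 2 ≤ N) {Λ : Set (ℝ × ℝ)}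
    (h : IsGaborONB (charFn (halfIntervals N)) Λ) : ScaledOrthogonal N (scaleSet N Λ) := by
  obtain ⟨b, hb⟩ := h
  have hN' : (2 : ℝ) ≤ N := by exact_mod_cast hN
  have horth : ∀ p ∈ Λ, ∀ q ∈ Λ, p ≠ q →
      ∫ x in {x | x - p.1 ∈ halfIntervals N ∧ x - q.1 ∈ halfIntervals N},
        expChar (q.2 - p.2) x = 0 := by
    intro p hp q hq hpq
    rw [← inner_eq_setIntegral (measurableSet_halfIntervals N) (measurableSet_halfIntervals N)
      (hb ⟨p, hp⟩) (hb ⟨q, hq⟩)]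
    exact b.orthonormal.inner_eq_zero (fun e => hpq (congrArg Subtype.val e))
  refine ⟨hN, ?_, ?_⟩
  · rintro _ ⟨p, hp, rfl⟩ _ ⟨q, hq, rfl⟩ hne h0 h1
    simp only at h0 h1 ⊢
    rcases integral_overlap_near hN (by linarith) (by linarith)
      (horth p hp q hq (fun e => hne (by rw [e]))) with ⟨k, hk⟩ | ⟨k, hk, e⟩
    · exact Or.inl ⟨k, by rw [← hk]; ring⟩
    · exact Or.inr ⟨k, hk, by rw [← e]; ring⟩
  · rintro _ ⟨p, hp, rfl⟩ _ ⟨q, hq, rfl⟩ u hu e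
    simp only at e ⊢
    have hne : p ≠ q := by
      rintro rfl
      have := (abs_lt.1 hu).1
      linarith
    obtain ⟨k, hk, e⟩ := integral_overlap_far hN hu (by linarith) (horth p hp q hq hne)
    exact ⟨k, hk, by rw [← e]; ring⟩

/-! ### The spectrogram -/

/-- Plancherel's identity for the indicator function of a subset of the unit interval. -/
theorem lintegral_enorm_integral_expChar {S : Set ℝ} (hS : MeasurableSet S)
    (hS1 : S ⊆ Set.Ico 0 1) :
    ∫⁻ ν : ℝ, ‖∫ x in S, expChar ν x‖ₑ ^ 2 = volume S := by
  have hfin : volume S ≠ ∞ := ((measure_mono hS1).trans_lt (by simp)).ne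
  -- Up to the sign of `n`, these integrals are the Fourier coefficients of `χ_S e^{2πiνx}` on the
  -- unit interval. Integrating over `ν` in a unit interval unfolds the sum to the whole line.
  have parseval : ∀ ν : ℝ, ∑' n : ℤ, ‖∫ x in S, expChar (ν + n) x‖ₑ ^ 2 = volume S := by
    intro ν
    have hmem : MemLp (S.indicator (expChar ν)) 2 (volume.restrict (Set.Ioc (0 : ℝ) 1)) := by
      refine MemLp.of_bound
        ((continuous_expChar ν).measurable.indicator hS).aestronglyMeasurable 1
        (Filter.Eventually.of_forall fun x => ?_)
      by_cases hx : x ∈ S <;> simp [hx, norm_expChar]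
    have hsum := hasSum_sq_fourierCoeffOn (zero_lt_one' ℝ) hmem
    have hcoeff : ∀ n : ℤ, fourierCoeffOn (zero_lt_one' ℝ) (S.indicator (expChar ν)) n =
        ∫ x in S, expChar (ν + (-n : ℤ)) x := by
      intro n
      rw [fourierCoeffOn_eq_integral, intervalIntegral.integral_of_le zero_le_one,
        ← integral_Ico_eq_integral_Ioc]
      have e : ∀ x : ℝ, fourier (-n) (x : AddCircle ((1 : ℝ) - 0)) • S.indicator (expChar ν) x =
          S.indicator (expChar (ν + (-n : ℤ))) x := by
        intro x
        by_cases hx : x ∈ S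
        · simp only [hx, Set.indicator_of_mem, fourier_coe_apply, smul_eq_mul]
          rw [expChar, expChar, ← Complex.exp_add]
          congr 1
          push_cast
          ring
        · simp [hx]
      simp_rw [e]
      rw [setIntegral_indicator hS, Set.inter_eq_right.2 hS1]
      simp
    have hval : ((1 : ℝ) - 0)⁻¹ • ∫ x in (0 : ℝ)..1, ‖S.indicator (expChar ν) x‖ ^ 2 =
        (volume S).toReal := by
      rw [intervalIntegral.integral_of_le zero_le_one, ← integral_Ico_eq_integral_Ioc]
      have e : ∀ x : ℝ, ‖S.indicator (expChar ν) x‖ ^ 2 = S.indicator (fun _ => (1 : ℝ)) x := by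
        intro x
        by_cases hx : x ∈ S <;> simp [hx, norm_expChar]
      simp_rw [e]
      rw [setIntegral_indicator hS, Set.inter_eq_right.2 hS1]
      simp [Measure.real]
    rw [hval] at hsum
    have h1 : ∑' n : ℤ, ENNReal.ofReal (‖fourierCoeffOn (zero_lt_one' ℝ)
        (S.indicator (expChar ν)) n‖ ^ 2) = volume S := by
      rw [← ENNReal.ofReal_tsum_of_nonneg (fun _ => by positivity) hsum.summable, hsum.tsum_eq,
        ENNReal.ofReal_toReal hfin]
    rw [← h1, ← (Equiv.neg ℤ).tsum_eq]
    refine tsum_congr fun n => ?_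
    rw [hcoeff, Equiv.neg_apply, ENNReal.ofReal_pow (norm_nonneg _), ofReal_norm]
  have hmeas : Measurable fun ν : ℝ => ‖∫ x in S, expChar ν x‖ₑ ^ 2 := by
    have hc : StronglyMeasurable (fun z : ℝ × ℝ => expChar z.1 z.2) := by
      refine Continuous.stronglyMeasurable ?_
      unfold expChar
      fun_prop
    exact (hc.integral_prod_right (ν := volume.restrict S)).measurable.enorm.pow_const 2
  set G : ℝ → ℝ≥0∞ := fun ν => ‖∫ x in S, expChar ν x‖ₑ ^ 2 with hG
  calc ∫⁻ ν, G ν = ∫⁻ ν in ⋃ n : ℤ, Set.Ioc ((0 : ℝ) + n) (0 + n + 1), G ν := by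
        rw [iUnion_Ioc_add_intCast, Measure.restrict_univ]
    _ = ∑' n : ℤ, ∫⁻ ν in Set.Ioc ((0 : ℝ) + n) (0 + n + 1), G ν :=
        lintegral_iUnion (fun _ => measurableSet_Ioc) (Set.pairwise_disjoint_Ioc_add_intCast 0) _
    _ = ∑' n : ℤ, ∫⁻ ν in Set.Ioc (0 : ℝ) 1, G (ν + n) := by
        refine tsum_congr fun n => ?_
        rw [← (measurePreserving_add_right (volume : Measure ℝ) (n : ℝ)).setLIntegral_comp_preimage_emb
          (measurableEmbedding_addRight (n : ℝ)) G]
        simp [add_comm]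
    _ = ∫⁻ ν in Set.Ioc (0 : ℝ) 1, ∑' n : ℤ, G (ν + n) :=
        (lintegral_tsum fun n => (hmeas.comp (measurable_id.add_const _)).aemeasurable).symm
    _ = volume S := by simp [hG, parseval]

/-- The part of `[0, 1/2)` that a translation by `t` moves into `[0, 1/2) ∪ [N/2, (N+1)/2)`. -/
def overlapSet (N : ℕ) (t : ℝ) : Set ℝ :=
  {u | u ∈ Set.Ico (0 : ℝ) (1 / 2) ∧ u + t ∈ halfIntervals N}

/-- The spectrogram of the indicator function of `[0, 1/2)` with respect to the window
`χ_{halfIntervals N}`. -/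
noncomputable def spectrogram (N : ℕ) (z : ℝ × ℝ) : ℝ≥0∞ :=
  ‖∫ u in overlapSet N z.1, expChar z.2 u‖ₑ ^ 2

theorem measurableSet_overlap (N : ℕ) :
    MeasurableSet {z : ℝ × ℝ | z.2 ∈ Set.Ico (0 : ℝ) (1 / 2) ∧ z.2 + z.1 ∈ halfIntervals N} :=
  (measurable_snd measurableSet_Ico).inter
    ((measurable_snd.add measurable_fst) (measurableSet_halfIntervals N))

theorem measurableSet_overlapSet (N : ℕ) (t : ℝ) : MeasurableSet (overlapSet N t) :=
  measurable_prodMk_left (x := t) (measurableSet_overlap N)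

theorem measurable_spectrogram (N : ℕ) : Measurable (spectrogram N) := by
  have hm : MeasurableSet {w : (ℝ × ℝ) × ℝ |
      w.2 ∈ Set.Ico (0 : ℝ) (1 / 2) ∧ w.2 + w.1.1 ∈ halfIntervals N} :=
    (measurable_snd measurableSet_Ico).inter
      ((measurable_snd.add measurable_fst.fst) (measurableSet_halfIntervals N))
  have hc : Continuous (fun w : (ℝ × ℝ) × ℝ => expChar w.1.2 w.2) := by
    unfold expChar
    fun_prop
  have h2 := ((hc.stronglyMeasurable.indicator hm).integral_prod_right'
    (ν := volume)).measurable.enorm.pow_const 2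
  convert h2 using 2 with z
  rw [spectrogram, ← integral_indicator (measurableSet_overlapSet N z.1)]
  rfl

/-- Plancherel in the frequency variable leaves the measure of the overlap; Fubini turns its
integral over `t` into the product of the lengths `1/2` and `1` of the two sets. -/
theorem lintegral_spectrogram {N : ℕ} (hN : 1 ≤ N) : ∫⁻ z, spectrogram N z = 1 / 2 := by
  rw [Measure.volume_eq_prod, lintegral_prod _ (measurable_spectrogram N).aemeasurable]
  have h1 : ∀ t : ℝ, ∫⁻ ν, spectrogram N (t, ν) = volume (overlapSet N t) := fun t =>
    lintegral_enorm_integral_expChar (measurableSet_overlapSet N t)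
      (fun u hu => ⟨hu.1.1, by linarith [hu.1.2]⟩)
  simp_rw [h1]
  have h2 := Measure.prod_apply (μ := volume) (ν := volume) (measurableSet_overlap N)
  have h3 := Measure.prod_apply_symm (μ := volume) (ν := volume) (measurableSet_overlap N)
  have h4 : ∀ u : ℝ, volume ((fun t : ℝ => (t, u)) ⁻¹'
      {z : ℝ × ℝ | z.2 ∈ Set.Ico (0 : ℝ) (1 / 2) ∧ z.2 + z.1 ∈ halfIntervals N}) =
      (Set.Ico (0 : ℝ) (1 / 2)).indicator 1 u := by
    intro u
    by_cases hu : u ∈ Set.Ico (0 : ℝ) (1 / 2)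
    · rw [Set.indicator_of_mem hu, Pi.one_apply, ← volume_halfIntervals hN,
        ← measure_preimage_add volume u (halfIntervals N)]
      congr 1
      ext t
      exact and_iff_right hu
    · rw [Set.indicator_of_notMem hu, ← measure_empty (μ := (volume : Measure ℝ))]
      congr 1
      ext t
      exact iff_of_false (fun ht => hu ht.1) (Set.notMem_empty t)
  simp_rw [h4] at h3
  rw [lintegral_indicator_one measurableSet_Ico, Real.volume_Ico, h2] at h3
  refine h3.trans ?_
  rw [sub_zero, ENNReal.ofReal_div_of_pos two_pos]
  simp

/-- On `(-1/2, 0] × (-1, 1)` the spectrogram does not vanish. -/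
theorem spectrogram_ne_zero {N : ℕ} (hN : 1 ≤ N) {z : ℝ × ℝ} (h1 : z.1 ∈ Set.Ioc (-(1 / 2) : ℝ) 0)
    (h2 : |z.2| < 1) : spectrogram N z ≠ 0 := by
  have hN' : (1 : ℝ) ≤ N := by exact_mod_cast hN
  obtain ⟨h3, h4⟩ := h1
  have hset : overlapSet N z.1 = Set.Ico (-z.1) (1 / 2) := by
    ext u
    simp only [overlapSet, halfIntervals, Set.mem_ofPred_eq, Set.mem_union, Set.mem_Ico]
    constructor
    · rintro ⟨⟨h5, h6⟩, ⟨h7, h8⟩ | ⟨h7, h8⟩⟩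
      · exact ⟨by linarith, h6⟩
      · linarith
    · rintro ⟨h5, h6⟩
      exact ⟨⟨by linarith, h6⟩, Or.inl ⟨by linarith, by linarith⟩⟩
  rw [spectrogram, hset]
  refine pow_ne_zero 2 (enorm_ne_zero.2 fun h => ?_)
  obtain ⟨k, hk, e⟩ := (integral_expChar_Ico_eq_zero_iff (by linarith)).1 h
  have h5 : (1 : ℝ) ≤ |(k : ℝ)| := by exact_mod_cast Int.one_le_abs hk
  rw [← e, abs_mul, abs_of_nonneg (by linarith : 0 ≤ 1 / 2 - -z.1)] at h5
  nlinarith [abs_nonneg z.2]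

/-- Parseval's identity for the Gabor basis, applied to the time-frequency shifts of the indicator
function of `[0, 1/2)`. -/
theorem tsum_spectrogram {N : ℕ} {Λ : Set (ℝ × ℝ)}
    (h : IsGaborONB (charFn (halfIntervals N)) Λ) (z : ℝ × ℝ) :
    ∑' p : Λ, spectrogram N (z - p) = 1 / 2 := by
  obtain ⟨b, hb⟩ := h
  have hmem : MemLp (timeFreqShift (charFn (Set.Ico 0 (1 / 2))) z) 2 volume := by
    have e : timeFreqShift (charFn (Set.Ico 0 (1 / 2))) z =
        (Set.Ico z.1 (z.1 + 1 / 2)).indicator (expChar z.2) := by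
      ext x
      have hx : x - z.1 ∈ Set.Ico (0 : ℝ) (1 / 2) ↔ x ∈ Set.Ico z.1 (z.1 + 1 / 2) := by
        simp only [Set.mem_Ico]
        constructor <;> rintro ⟨_, _⟩ <;> constructor <;> linarith
      by_cases hx' : x ∈ Set.Ico z.1 (z.1 + 1 / 2)
      · rw [Set.indicator_of_mem hx', timeFreqShift, charFn, Set.indicator_of_mem (hx.2 hx'),
          one_mul]
      · rw [Set.indicator_of_notMem hx', timeFreqShift, charFn,
          Set.indicator_of_notMem (fun hc => hx' (hx.1 hc)), zero_mul]
    rw [e, memLp_indicator_iff_restrict measurableSet_Ico]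
    exact MemLp.of_bound (continuous_expChar _).aestronglyMeasurable 1
      (Filter.Eventually.of_forall fun x => (norm_expChar _ _).le)
  set f := hmem.toLp with hf
  have hfae : (f : ℝ → ℂ) =ᵐ[volume] timeFreqShift (charFn (Set.Ico 0 (1 / 2))) z :=
    hmem.coeFn_toLp
  have hff : inner ℂ f f = ((1 / 2 : ℝ) : ℂ) := by
    rw [inner_eq_setIntegral measurableSet_Ico measurableSet_Ico hfae hfae]
    have e : {x : ℝ | x - z.1 ∈ Set.Ico (0 : ℝ) (1 / 2) ∧ x - z.1 ∈ Set.Ico (0 : ℝ) (1 / 2)} =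
        Set.Ico z.1 (z.1 + 1 / 2) := by
      ext x
      simp only [Set.mem_ofPred_eq, and_self, Set.mem_Ico]
      constructor <;> rintro ⟨_, _⟩ <;> constructor <;> linarith
    rw [e, sub_self]
    simp [expChar_zero_left]
  -- Translating the integration variable by `z.1` only contributes a unimodular factor.
  have hinner : ∀ p : Λ, ENNReal.ofReal (‖inner ℂ (b p) f‖ ^ 2) = spectrogram N (z - p) := by
    intro p
    rw [inner_eq_setIntegral measurableSet_Ico (measurableSet_halfIntervals N) (hb p) hfae,
      setIntegral_expChar_translate (S := overlapSet N (z.1 - (p : ℝ × ℝ).1)) _ z.1, norm_mul,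
      norm_expChar, one_mul, spectrogram, ENNReal.ofReal_pow (norm_nonneg _), ofReal_norm]
    · rfl
    · intro u
      simp only [overlapSet, Set.mem_ofPred_eq, add_sub_cancel_right, add_sub_assoc]
      exact and_comm
  have hsum := b.hasSum_inner_mul_inner f f
  have hterm : ∀ p : Λ, inner ℂ f (b p) * inner ℂ (b p) f =
      ((‖inner ℂ (b p) f‖ ^ 2 : ℝ) : ℂ) := by
    intro p
    rw [← inner_conj_symm, RCLike.conj_mul]
    norm_cast
  simp_rw [hterm] at hsum
  rw [hff, Complex.hasSum_ofReal] at hsum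
  simp_rw [← hinner]
  rw [← ENNReal.ofReal_tsum_of_nonneg (fun _ => by positivity) hsum.summable, hsum.tsum_eq,
    ENNReal.ofReal_div_of_pos two_pos]
  simp

/-! ### From packing to tiling -/

/-- If the translates of `F` along `Λ` sum to the integral of `F`, and the translates of a set `D`
of measure one along `Λ` are disjoint, then `F` vanishes where these translates do not reach. -/
theorem setLIntegral_eq_zero_of_packing {Λ : Set (ℝ × ℝ)} [Countable Λ] {F : ℝ × ℝ → ℝ≥0∞}
    (hF : Measurable F) {c : ℝ≥0∞} (hc : c ≠ ∞) (hsum : ∀ z, ∑' p : Λ, F (z - p) = c)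
    (hint : ∫⁻ z, F z = c) {D : Set (ℝ × ℝ)} (hD : MeasurableSet D) (hD1 : volume D = 1)
    (hpack : ∀ w, ∀ p ∈ Λ, ∀ q ∈ Λ, w - p ∈ D → w - q ∈ D → p = q) {B : Set (ℝ × ℝ)}
    (hB : MeasurableSet B) {w : ℝ × ℝ} (hw : ∀ y ∈ B, ∀ p ∈ Λ, w - p - y ∉ D) :
    ∫⁻ y in B, F y = 0 := by
  -- The number of translates hit is at most one by packing, and zero on `B`. Integrating the
  -- summation identity over `D` and unfolding weights `F` by this number, so already the complement
  -- of `B` carries the full integral `c`.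
  have hcount : ∀ y, ∑' p : Λ, D.indicator (1 : ℝ × ℝ → ℝ≥0∞) (w - p - y) ≤
      Bᶜ.indicator (1 : ℝ × ℝ → ℝ≥0∞) y := by
    intro y
    by_cases hex : ∃ p : Λ, w - p - y ∈ D
    · obtain ⟨p, hp⟩ := hex
      rw [tsum_eq_single p, Set.indicator_of_mem hp,
        Set.indicator_of_mem (Set.mem_compl fun hy => hw y hy p p.2 hp)]
      · exact le_rfl
      · intro q hqp
        refine Set.indicator_of_notMem (fun hq => hqp (Subtype.ext ?_)) _
        exact hpack (w - y) q q.2 p p.2 (by rwa [sub_right_comm]) (by rwa [sub_right_comm])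
    · push Not at hex
      simp [hex]
  have h1 : c ≤ ∫⁻ y in Bᶜ, F y := calc
    c = ∫⁻ d in D, ∑' p : Λ, F (w - d - p) := by simp [hsum, hD1]
    _ = ∑' p : Λ, ∫⁻ d in D, F (w - d - p) :=
        lintegral_tsum fun p => (hF.comp (by fun_prop)).aemeasurable
    _ = ∑' p : Λ, ∫⁻ y, D.indicator 1 (w - p - y) * F y := by
        refine tsum_congr fun p => ?_
        rw [← lintegral_indicator hD, ← lintegral_sub_left_eq_self _ (w - (p : ℝ × ℝ))]
        refine lintegral_congr fun y => ?_
        by_cases hy : w - p - y ∈ D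
        · rw [Set.indicator_of_mem hy, Set.indicator_of_mem hy, Pi.one_apply, one_mul]
          congr 1
          abel
        · rw [Set.indicator_of_notMem hy, Set.indicator_of_notMem hy, zero_mul]
    _ = ∫⁻ y, ∑' p : Λ, D.indicator 1 (w - p - y) * F y :=
        (lintegral_tsum fun p => (((measurable_one.indicator hD).comp
          (by fun_prop)).mul hF).aemeasurable).symm
    _ ≤ ∫⁻ y, Bᶜ.indicator 1 y * F y := by
        refine lintegral_mono fun y => ?_
        rw [ENNReal.tsum_mul_right]
        exact mul_le_mul_left (hcount y) _
    _ = ∫⁻ y in Bᶜ, F y := by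
        rw [← lintegral_indicator hB.compl]
        refine lintegral_congr fun y => ?_
        by_cases hy : y ∈ Bᶜ
        · rw [Set.indicator_of_mem hy, Set.indicator_of_mem hy, Pi.one_apply, one_mul]
        · rw [Set.indicator_of_notMem hy, Set.indicator_of_notMem hy, zero_mul]
  have h2 := lintegral_add_compl F hB (μ := volume)
  rw [hint] at h2
  have h3 : (∫⁻ y in B, F y) + c ≤ 0 + c := by
    rw [zero_add]
    exact (add_le_add le_rfl h1).trans h2.le
  exact nonpos_iff_eq_zero.1 ((ENNReal.add_le_add_iff_right hc).1 h3)

/-- Two points in one unit square would have a frequency gap below one in absolute value, neither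
odd nor at least `2N`. This yields the countability and local finiteness of the set. -/
theorem ScaledOrthogonal.injOn_floor {N : ℕ} {Λ : Set (ℝ × ℝ)} (h : ScaledOrthogonal N Λ) :
    Set.InjOn (fun p : ℝ × ℝ => (⌊p.1⌋, ⌊p.2⌋)) Λ := by
  intro p hp q hq hpq
  wlog hle : 0 ≤ q.1 - p.1 generalizing p q
  · exact (this hq hp hpq.symm (by linarith)).symm
  by_contra hne
  have hN : (2 : ℝ) ≤ N := by exact_mod_cast h.two_le
  have h1 := Int.abs_sub_lt_one_of_floor_eq_floor (congrArg Prod.fst hpq)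
  have h2 := Int.abs_sub_lt_one_of_floor_eq_floor (congrArg Prod.snd hpq)
  rw [abs_sub_comm] at h1 h2
  have h3 := (abs_lt.1 h1).2
  rcases h.near p hp q hq hne hle h3 with ⟨k, hk⟩ | ⟨k, hk, e⟩
  · rw [hk, abs_lt] at h2
    have h4 : (-1 : ℤ) < 2 * k + 1 := by exact_mod_cast h2.1
    have h5 : 2 * k + 1 < (1 : ℤ) := by exact_mod_cast h2.2
    omega
  · linarith [le_abs_of_mul_eq hk (by linarith) (by linarith) e]

theorem ScaledOrthogonal.countable {N : ℕ} {Λ : Set (ℝ × ℝ)} (h : ScaledOrthogonal N Λ) :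
    Λ.Countable :=
  Set.countable_of_injective_of_countable_image h.injOn_floor (Set.to_countable _)

theorem ScaledOrthogonal.finite_inter {N : ℕ} {Λ : Set (ℝ × ℝ)} (h : ScaledOrthogonal N Λ)
    (a b c d : ℝ) : {p ∈ Λ | p.1 ∈ Set.Icc a b ∧ p.2 ∈ Set.Icc c d}.Finite := by
  refine Set.Finite.of_injOn (t := Set.Icc ⌊a⌋ ⌊b⌋ ×ˢ Set.Icc ⌊c⌋ ⌊d⌋) ?_
    (h.injOn_floor.mono fun p hp => hp.1) ((Set.finite_Icc _ _).prod (Set.finite_Icc _ _))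
  rintro p ⟨-, ⟨h1, h2⟩, h3, h4⟩
  exact ⟨⟨Int.floor_mono h1, Int.floor_mono h2⟩, Int.floor_mono h3, Int.floor_mono h4⟩

/-- Half-open intervals make the uncovered set open to the right only, hence the one-sided
neighbourhoods. -/
theorem eventually_notMem_Ico {x c a b : ℝ} (h : x - c ∉ Set.Ico a b) :
    ∀ᶠ x' in nhdsWithin x (Set.Ici x), x' - c ∉ Set.Ico a b := by
  rcases lt_or_ge (x - c) a with h1 | h1
  · filter_upwards [nhdsWithin_le_nhds (eventually_lt_nhds (show x < a + c by linarith))]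
      with x' hx' hm
    linarith [hm.1]
  · have h2 : b ≤ x - c := not_lt.1 fun hb => h ⟨h1, hb⟩
    filter_upwards [self_mem_nhdsWithin] with x' hx' hm
    have : x ≤ x' := hx'
    linarith [hm.2]

theorem eventually_not_inTimeCell {N : ℕ} {x c : ℝ} (h : ¬ InTimeCell N (x - c)) :
    ∀ᶠ x' in nhdsWithin x (Set.Ici x), ¬ InTimeCell N (x' - c) := by
  have h' := not_or.1 h
  filter_upwards [eventually_notMem_Ico h'.1, eventually_notMem_Ico h'.2] with x' h1 h2
  exact not_or.2 ⟨h1, h2⟩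

theorem eventually_not_inFreqCell {N : ℕ} {y c : ℝ} (h : ¬ InFreqCell N (y - c)) :
    ∀ᶠ y' in nhdsWithin y (Set.Ici y), ¬ InFreqCell N (y' - c) := by
  have : ∀ᶠ y' in nhdsWithin y (Set.Ici y), ∀ j ∈ Finset.range N,
      y' - c ∉ Set.Ico (2 * j : ℝ) (2 * j + 1) := by
    rw [Filter.eventually_all_finset]
    exact fun j hj => eventually_notMem_Ico fun hm => h ⟨j, Finset.mem_range.1 hj, hm⟩
  filter_upwards [this] with y' hy'
  rintro ⟨j, hj, hm⟩
  exact hy' j (Finset.mem_range.2 hj) hm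

/-- The points that the tiles do not cover contain with every point a small square to the upper
right of it. -/
theorem ScaledOrthogonal.exists_uncovered_square {N : ℕ} {Λ : Set (ℝ × ℝ)}
    (h : ScaledOrthogonal N Λ) {x y : ℝ}
    (hxy : ∀ p ∈ Λ, ¬ (InTimeCell N (x - p.1) ∧ InFreqCell N (y - p.2))) :
    ∃ ε > 0, ∀ x' ∈ Set.Ico x (x + ε), ∀ y' ∈ Set.Ico y (y + ε), ∀ p ∈ Λ,
      ¬ (InTimeCell N (x' - p.1) ∧ InFreqCell N (y' - p.2)) := by
  -- Only tiles based in this box can meet the unit square to the upper right of `(x, y)`.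
  have hfin := h.finite_inter (x - N - 1) (x + 1) (y - 2 * N) (y + 1)
  have hev : ∀ᶠ z in nhdsWithin x (Set.Ici x) ×ˢ nhdsWithin y (Set.Ici y),
      ∀ p ∈ {p ∈ Λ | p.1 ∈ Set.Icc (x - N - 1) (x + 1) ∧ p.2 ∈ Set.Icc (y - 2 * N) (y + 1)},
        ¬ (InTimeCell N (z.1 - p.1) ∧ InFreqCell N (z.2 - p.2)) := by
    rw [Filter.eventually_all_finite hfin]
    intro p hp
    rcases not_and_or.1 (hxy p hp.1) with h1 | h1
    · exact ((eventually_not_inTimeCell h1).prod_inl _).mono fun z hz => fun hc => hz hc.1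
    · exact ((eventually_not_inFreqCell h1).prod_inr _).mono fun z hz => fun hc => hz hc.2
  obtain ⟨P, hP, Q, hQ, hPQ⟩ := Filter.eventually_prod_iff.1 hev
  obtain ⟨u, hu, hu'⟩ := mem_nhdsGE_iff_exists_Ico_subset.1 hP
  obtain ⟨v, hv, hv'⟩ := mem_nhdsGE_iff_exists_Ico_subset.1 hQ
  have hu0 : x < u := hu
  have hv0 : y < v := hv
  refine ⟨min 1 (min (u - x) (v - y)),
    lt_min one_pos (lt_min (by linarith) (by linarith)), ?_⟩
  rintro x' ⟨hx1, hx2⟩ y' ⟨hy1, hy2⟩ p hp ⟨hc1, hc2⟩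
  have e1 : min 1 (min (u - x) (v - y)) ≤ 1 := min_le_left _ _
  have e2 : min 1 (min (u - x) (v - y)) ≤ u - x := (min_le_right _ _).trans (min_le_left _ _)
  have e3 : min 1 (min (u - x) (v - y)) ≤ v - y := (min_le_right _ _).trans (min_le_right _ _)
  refine hPQ (hu' ⟨hx1, by linarith⟩) (hv' ⟨hy1, by linarith⟩) p ⟨hp, ?_, ?_⟩ ⟨hc1, hc2⟩
  · have hN : (0 : ℝ) ≤ N := by positivity
    rcases hc1 with ⟨h1, h2⟩ | ⟨h1, h2⟩
    · exact ⟨by linarith, by linarith⟩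
    · exact ⟨by linarith, by linarith⟩
  · obtain ⟨j, hj, h1, h2⟩ := hc2
    have hj' : (j : ℝ) + 1 ≤ N := by exact_mod_cast hj
    have hj0 : (0 : ℝ) ≤ j := by positivity
    exact ⟨by linarith, by linarith⟩

/-- The set whose translates along `Λ` tile the plane. -/
def tileSet (N : ℕ) : Set (ℝ × ℝ) :=
  halfIntervals N ×ˢ {ν : ℝ | InFreqCell N (N * ν)}

theorem setOf_inFreqCell_mul {N : ℕ} (hN : 0 < N) : {ν : ℝ | InFreqCell N (N * ν)} =
    ⋃ j ∈ Finset.range N, Set.Ico (2 * j / N : ℝ) ((2 * j + 1) / N) := by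
  have hN' : (0 : ℝ) < N := by exact_mod_cast hN
  ext ν
  simp only [InFreqCell, Set.mem_ofPred_eq, Set.mem_iUnion, Finset.mem_range, exists_prop,
    Set.mem_Ico, div_le_iff₀' hN', lt_div_iff₀' hN']

theorem measurableSet_tileSet {N : ℕ} (hN : 0 < N) : MeasurableSet (tileSet N) := by
  refine (measurableSet_halfIntervals N).prod ?_
  rw [setOf_inFreqCell_mul hN]
  exact Finset.measurableSet_biUnion _ fun j _ => measurableSet_Ico

theorem volume_tileSet {N : ℕ} (hN : 0 < N) : volume (tileSet N) = 1 := by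
  have hN' : (0 : ℝ) < N := by exact_mod_cast hN
  rw [tileSet, Measure.volume_eq_prod, Measure.prod_prod, volume_halfIntervals hN, one_mul,
    setOf_inFreqCell_mul hN, measure_biUnion_finset _ fun j _ => measurableSet_Ico]
  · have h1 : ∀ j : ℕ, volume (Set.Ico (2 * j / N : ℝ) ((2 * j + 1) / N)) =
        ENNReal.ofReal (1 / N) := fun j => by
      rw [Real.volume_Ico]
      congr 1
      ring
    simp_rw [h1]
    rw [Finset.sum_const, Finset.card_range, nsmul_eq_mul, ← ENNReal.ofReal_natCast,
      ← ENNReal.ofReal_mul hN'.le, mul_one_div_cancel hN'.ne', ENNReal.ofReal_one]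
  · intro i _ j _ hij
    refine Set.disjoint_left.2 ?_
    rintro x ⟨h1, h2⟩ ⟨h3, h4⟩
    rw [div_le_iff₀' hN'] at h1 h3
    rw [lt_div_iff₀' hN'] at h2 h4
    have h5 : (2 * i : ℤ) < 2 * j + 1 := by
      have : (2 * i : ℝ) < 2 * j + 1 := by linarith
      exact_mod_cast this
    have h6 : (2 * j : ℤ) < 2 * i + 1 := by
      have : (2 * j : ℝ) < 2 * i + 1 := by linarith
      exact_mod_cast this
    omega

/-- A Gabor orthonormal basis with window `χ_{halfIntervals N}` yields a tiling of the plane. -/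
theorem scaledTiling_of_isGaborONB {N : ℕ} (hN : 2 ≤ N) {Λ : Set (ℝ × ℝ)}
    (h : IsGaborONB (charFn (halfIntervals N)) Λ) : ScaledTiling N (scaleSet N Λ) := by
  have ho := scaledOrthogonal_of_isGaborONB hN h
  have hN' : (2 : ℝ) ≤ N := by exact_mod_cast hN
  have hN0 : (N : ℝ) ≠ 0 := by positivity
  refine ⟨ho, fun x y => ?_⟩
  by_contra hcov
  push Not at hcov
  obtain ⟨ε, hε, hunc⟩ := ho.exists_uncovered_square (x := x) (y := y)
    fun p hp hc => hcov p hp hc.1 hc.2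
  have hinj : Function.Injective (fun p : ℝ × ℝ => (2 * p.1, (N : ℝ) * p.2)) := by
    intro p q hpq
    obtain ⟨h1, h2⟩ := Prod.mk.inj hpq
    exact Prod.ext (mul_left_cancel₀ two_ne_zero h1) (mul_left_cancel₀ hN0 h2)
  have hcount : Countable Λ :=
    (Set.countable_of_injective_of_countable_image hinj.injOn ho.countable).to_subtype
  -- The bound `1/2` keeps `B` where the spectrogram does not vanish; `ε / N` keeps its reflected
  -- and rescaled copy inside the uncovered square.
  set δ := min (1 / 2) (ε / N) with hδ
  have hδ0 : 0 < δ := lt_min (by norm_num) (by positivity)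
  have hδ1 : δ ≤ 1 / 2 := min_le_left _ _
  have hδN : N * δ ≤ ε := by
    have : δ ≤ ε / N := min_le_right _ _
    rwa [le_div_iff₀' (by positivity)] at this
  have hδ2 : 2 * δ ≤ ε := (mul_le_mul_of_nonneg_right hN' hδ0.le).trans hδN
  set B : Set (ℝ × ℝ) := Set.Ioc (-δ) 0 ×ˢ Set.Ioc (-δ) 0 with hB
  have hBm : MeasurableSet B := measurableSet_Ioc.prod measurableSet_Ioc
  have hzero : ∫⁻ z in B, spectrogram N z = 0 := by
    refine setLIntegral_eq_zero_of_packing (measurable_spectrogram N) (c := 1 / 2) (by simp)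
      (tsum_spectrogram h) (lintegral_spectrogram (N := N) (by omega))
      (measurableSet_tileSet (N := N) (by omega)) (volume_tileSet (by omega)) ?_ hBm
      (w := (x / 2, y / N)) ?_
    · rintro w p hp q hq ⟨hp1, hp2⟩ ⟨hq1, hq2⟩
      rw [mem_halfIntervals_iff] at hp1 hq1
      refine hinj (ho.packing (Set.mem_image_of_mem _ hp) (Set.mem_image_of_mem _ hq)
        (x := 2 * w.1) (y := N * w.2) ?_ ?_ ?_ ?_)
      · rw [← mul_sub]; exact hp1
      · rw [← mul_sub]; exact hp2
      · rw [← mul_sub]; exact hq1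
      · rw [← mul_sub]; exact hq2
    · rintro z ⟨⟨h1, h2⟩, h3, h4⟩ p hp ⟨h5, h6⟩
      rw [mem_halfIntervals_iff] at h5
      have h7 : N * (-δ) < N * z.2 := by gcongr
      have h8 : N * z.2 ≤ 0 := mul_nonpos_of_nonneg_of_nonpos (by positivity) h4
      refine hunc (x - 2 * z.1) ⟨by linarith, by linarith⟩ (y - N * z.2)
        ⟨by linarith, by linarith⟩ _ (Set.mem_image_of_mem _ hp) ⟨?_, ?_⟩
      · convert h5 using 1
        simp only [Prod.fst_sub]
        ring
      · have h6' : InFreqCell N (N * ((x / 2, y / (N : ℝ)) - p - z).2) := h6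
        convert h6' using 1
        simp only [Prod.snd_sub]
        field_simp
        ring
  rw [lintegral_eq_zero_iff (measurable_spectrogram N), Filter.EventuallyEq,
    ae_restrict_iff' hBm] at hzero
  have hB0 : volume B = 0 := by
    refine measure_mono_null (fun z hz => ?_) (ae_iff.1 hzero)
    intro hc
    refine spectrogram_ne_zero (by omega) ⟨?_, hz.1.2⟩ ?_ (hc hz)
    · linarith [hz.1.1]
    · exact abs_lt.2 ⟨by linarith [hz.2.1], by linarith [hz.2.2]⟩
  rw [hB, Measure.volume_eq_prod, Measure.prod_prod, Real.volume_Ioc] at hB0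
  simp [hδ0.not_ge] at hB0

/-! ### Exponential bases on the translates -/

theorem mem_shiftSet_iff {Ω : Set ℝ} {t x : ℝ} : x ∈ shiftSet Ω t ↔ x - t ∈ Ω := by
  constructor
  · rintro ⟨u, hu, rfl⟩
    simpa using hu
  · exact fun h => ⟨x - t, h, by simp⟩

/-- If the window of a Gabor orthonormal basis is an indicator function, and a translate of its
support is disjoint from all the other ones, then the frequencies at this translate give an
orthonormal basis of exponentials. -/
theorem IsGaborONB.isOrthonormalBasisL2_restrict {Ω : Set ℝ} {Λ : Set (ℝ × ℝ)}
    (h : IsGaborONB (charFn Ω) Λ) (hΩ : MeasurableSet Ω) (hfin : volume Ω ≠ ∞) (t : ℝ)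
    (hdisj : ∀ p ∈ Λ, p.1 ≠ t → Disjoint (shiftSet Ω p.1) (shiftSet Ω t)) :
    IsOrthonormalBasisL2 (volume.restrict (shiftSet Ω t))
      (fun ν : {ν : ℝ | (t, ν) ∈ Λ} => expChar (ν : ℝ)) := by
  classical
  obtain ⟨b, hb⟩ := h
  set S := shiftSet Ω t with hS
  have hSset : S = {x : ℝ | x - t ∈ Ω} := Set.ext fun x => mem_shiftSet_iff
  have hSm : MeasurableSet S := hSset ▸ measurableSet_sub_mem hΩ t
  have hSfin : volume S ≠ ∞ := by
    have : volume S = volume Ω := by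
      rw [hSset]
      exact (measurePreserving_sub_right volume t).measure_preimage hΩ.nullMeasurableSet
    rwa [this]
  have : IsFiniteMeasure (volume.restrict S) := ⟨by simpa using hSfin.lt_top⟩
  have hmem : ∀ ν : ℝ, MemLp (expChar ν) 2 (volume.restrict S) := fun ν =>
    MemLp.of_bound (continuous_expChar ν).aestronglyMeasurable 1
      (Filter.Eventually.of_forall fun x => (norm_expChar _ _).le)
  set e : {ν : ℝ | (t, ν) ∈ Λ} → Lp ℂ 2 (volume.restrict S) := fun ν => (hmem ν).toLp with he
  have heae : ∀ ν, (e ν : ℝ → ℂ) =ᵐ[volume.restrict S] expChar ν := fun ν =>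
    (hmem ν).coeFn_toLp
  have horth : Orthonormal ℂ e := by
    rw [orthonormal_iff_ite]
    intro ν μ
    have h1 : inner ℂ (e ν) (e μ) = inner ℂ (b ⟨(t, ν), ν.2⟩) (b ⟨(t, μ), μ.2⟩) := by
      rw [inner_eq_setIntegral hΩ hΩ (hb ⟨(t, ν), ν.2⟩) (hb ⟨(t, μ), μ.2⟩), L2.inner_def]
      have h2 : {x : ℝ | x - t ∈ Ω ∧ x - t ∈ Ω} = S := by
        rw [hSset]
        ext x
        simp only [Set.mem_ofPred_eq, and_self]
      rw [h2]
      refine integral_congr_ae ?_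
      filter_upwards [heae ν, heae μ] with x h3 h4
      rw [h3, h4, RCLike.inner_apply, expChar_mul_conj]
    rw [h1, orthonormal_iff_ite.1 b.orthonormal]
    refine if_congr ?_ rfl rfl
    constructor
    · intro h2
      exact Subtype.ext (congrArg (fun p : Λ => (p : ℝ × ℝ).2) h2)
    · rintro rfl
      rfl
  -- A function on `S` orthogonal to these exponentials, extended by zero, is orthogonal to the
  -- whole Gabor basis, since all other windows miss `S`.
  have hbot : (Submodule.span ℂ (Set.range e))ᗮ = ⊥ := by
    rw [Submodule.eq_bot_iff]
    intro f hf
    have hfe : ∀ ν, inner ℂ (e ν) f = 0 := fun ν =>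
      (Submodule.mem_orthogonal _ _).1 hf _ (Submodule.subset_span ⟨ν, rfl⟩)
    have hfm : MemLp (S.indicator f) 2 volume :=
      (memLp_indicator_iff_restrict hSm).2 (Lp.memLp f)
    set g := hfm.toLp with hg
    have hgae : (g : ℝ → ℂ) =ᵐ[volume] S.indicator f := hfm.coeFn_toLp
    have hbg : ∀ p, inner ℂ (b p) g = 0 := by
      rintro ⟨⟨t', ν⟩, hp⟩
      rw [L2.inner_def]
      by_cases ht : t' = t
      · subst ht
        rw [← hfe ⟨ν, hp⟩, L2.inner_def, ← integral_indicator hSm]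
        have h1 := (ae_restrict_iff' hSm).1 (heae ⟨ν, hp⟩)
        refine integral_congr_ae ?_
        filter_upwards [hgae, hb ⟨(t', ν), hp⟩, h1] with x h2 h3 h4
        rw [h2, h3]
        by_cases hx : x ∈ S
        · rw [Set.indicator_of_mem hx, Set.indicator_of_mem hx, h4 hx, timeFreqShift, charFn,
            Set.indicator_of_mem (mem_shiftSet_iff.1 hx), one_mul]
        · rw [Set.indicator_of_notMem hx, Set.indicator_of_notMem hx, inner_zero_right]
      · refine integral_eq_zero_of_ae ?_
        filter_upwards [hgae, hb ⟨(t', ν), hp⟩] with x h2 h3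
        rw [h2, h3]
        by_cases hx : x ∈ S
        · have hx' : x - t' ∉ Ω := fun hc =>
            Set.disjoint_left.1 (hdisj _ hp ht) (mem_shiftSet_iff.2 hc) hx
          rw [timeFreqShift, charFn, Set.indicator_of_notMem hx', zero_mul, inner_zero_left]
          rfl
        · rw [Set.indicator_of_notMem hx, inner_zero_right]
          rfl
    have hg0 : g = 0 := by
      have h1 := b.hasSum_inner_mul_inner g g
      simp_rw [hbg, mul_zero] at h1
      exact inner_self_eq_zero.1 (h1.unique hasSum_zero)
    rw [Lp.eq_zero_iff_ae_eq_zero] at hg0 ⊢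
    refine (ae_restrict_iff' hSm).2 ?_
    filter_upwards [hgae, hg0] with x h1 h2 hx
    rw [h1, Set.indicator_of_mem hx] at h2
    exact h2
  refine ⟨HilbertBasis.mkOfOrthogonalEqBot horth hbot, fun ν => ?_⟩
  rw [HilbertBasis.coe_mkOfOrthogonalEqBot]
  exact heae ν

theorem mem_scaleSet_iff {N : ℕ} (hN : N ≠ 0) {Λ : Set (ℝ × ℝ)} {t ν : ℝ} :
    (2 * t, N * ν) ∈ scaleSet N Λ ↔ (t, ν) ∈ Λ := by
  have hN' : (N : ℝ) ≠ 0 := by exact_mod_cast hN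
  constructor
  · rintro ⟨p, hp, e⟩
    obtain ⟨h1, h2⟩ := Prod.mk.inj e
    have : p = (t, ν) := Prod.ext (mul_left_cancel₀ two_ne_zero h1) (mul_left_cancel₀ hN' h2)
    exact this ▸ hp
  · exact fun h => ⟨(t, ν), h, rfl⟩

theorem twoIntervals_half {n : ℕ} {α β : ℝ} (hα : α = 1 / 2) (hn : β = (n : ℝ) / 2) :
    twoIntervals α β = halfIntervals (n + 1) := by
  subst hα hn
  unfold twoIntervals halfIntervals
  push_cast
  congr 2 <;> ring

/-! ### Standard form and lattice structure -/

section Structure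

variable {N : ℕ} {Λ : Set (ℝ × ℝ)}

/-- The translates of the window at the occurring times are pairwise disjoint. -/
theorem ScaledTiling.disjoint_shiftSet (h : ScaledTiling N (scaleSet N Λ)) {p q : ℝ × ℝ}
    (hp : p ∈ Λ) (hq : q ∈ Λ) (hpq : p.1 ≠ q.1) :
    Disjoint (shiftSet (halfIntervals N) p.1) (shiftSet (halfIntervals N) q.1) := by
  rw [Set.disjoint_left]
  intro x hxp hxq
  rw [mem_shiftSet_iff, mem_halfIntervals_iff, mul_sub] at hxp hxq
  -- The given tiles need not share a row; they are replaced by tiles at the same times that meet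
  -- the row at height 0, where packing applies.
  obtain ⟨r, hr, hr1, hry⟩ := h.exists_at_time (Set.mem_image_of_mem _ hp) 0
  obtain ⟨r', hr', hr1', hry'⟩ := h.exists_at_time (Set.mem_image_of_mem _ hq) 0
  have := h.packing hr hr' (x := 2 * x) (y := 0) (by rw [hr1]; exact hxp) hry
    (by rw [hr1']; exact hxq) hry'
  rw [this, hr1'] at hr1
  simp only at hr1
  exact hpq (by linarith)

theorem isStandard_of_scaledTiling (h : ScaledTiling N (scaleSet N Λ))
    (hΛ : IsGaborONB (charFn (halfIntervals N)) Λ) : IsStandard (halfIntervals N) Λ := by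
  have hN := h.two_le
  refine ⟨{t | ∃ ν, (t, ν) ∈ Λ}, fun t => {ν | (t, ν) ∈ Λ}, ?_, ?_, ?_, ?_⟩
  · ext ⟨t, ν⟩
    simp only [Set.mem_iUnion, Set.mem_prod, Set.mem_singleton_iff, Set.mem_ofPred_eq,
      exists_prop]
    constructor
    · exact fun hp => ⟨t, ⟨ν, hp⟩, rfl, hp⟩
    · rintro ⟨_, -, rfl, hp⟩
      exact hp
  · refine Set.eq_univ_of_forall fun x => ?_
    obtain ⟨_, ⟨p, hp, rfl⟩, hx, -⟩ := h.cover (2 * x) 0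
    refine Set.mem_biUnion (x := p.1) ⟨p.2, hp⟩ ?_
    rw [mem_shiftSet_iff, mem_halfIntervals_iff, mul_sub]
    exact hx
  · rintro t ⟨ν, hp⟩ t' ⟨ν', hq⟩ htt'
    exact h.disjoint_shiftSet hp hq htt'
  · rintro t ⟨ν, hq⟩
    refine hΛ.isOrthonormalBasisL2_restrict (measurableSet_halfIntervals N) ?_ t
      fun p hp hpt => h.disjoint_shiftSet hp hq hpt
    rw [volume_halfIntervals (by omega)]
    exact ENNReal.one_ne_top

/-- The lattice structure of `Λ`. -/
theorem exists_lattice_structure (h : ScaledTiling N (scaleSet N Λ)) :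
    ∃ (s : ℝ) (K : Set ℤ) (L : ℤ → Set ℤ) (a : ℤ → ℝ),
      ((0, 0) ∈ Λ → s = 0) ∧
      Λ = ⋃ k ∈ K, ({s + (k : ℝ) / 2} : Set ℝ) ×ˢ ((fun l : ℤ => ((l : ℝ) + a k) / N) '' L k) ∧
      (∀ k, a k ∈ Set.Ico (0 : ℝ) 1) ∧
      K ∪ (fun k : ℤ => (N : ℤ) + k) '' K = Set.univ ∧
      Disjoint K ((fun k : ℤ => (N : ℤ) + k) '' K) ∧
      ∀ k ∈ K, ∀ z : ℤ, ∃ l ∈ L k, ∃ j : ℕ, j < N ∧ l + 2 * j = z ∧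
        ∀ l' ∈ L k, ∀ j' : ℕ, j' < N → l' + 2 * j' = z → l' = l := by
  have hN : N ≠ 0 := by have := h.two_le; omega
  have hN' : (N : ℝ) ≠ 0 := by exact_mod_cast hN
  obtain ⟨p₀, hp₀, hp₀0⟩ : ∃ p ∈ Λ, (0, 0) ∈ Λ → p.1 = 0 := by
    by_cases h0 : ((0 : ℝ), (0 : ℝ)) ∈ Λ
    · exact ⟨_, h0, fun _ => rfl⟩
    · obtain ⟨_, ⟨p, hp, rfl⟩, -⟩ := h.cover 0 0
      exact ⟨p, hp, fun hc => absurd hc h0⟩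
  have hcell0 : ∀ t : ℝ, InTimeCell N (t - t) := fun t => Or.inl (by simp)
  -- The scaled frequencies at one time lie in one column, hence in one class modulo one. At a time
  -- that does not occur the offset is 0 by default.
  have hoff : ∀ k : ℤ, ∃ a ∈ Set.Ico (0 : ℝ) 1, ∀ ν, (p₀.1 + (k : ℝ) / 2, ν) ∈ Λ →
      ∃ l : ℤ, N * ν = l + a := by
    intro k
    by_cases hk : ∃ ν, (p₀.1 + (k : ℝ) / 2, ν) ∈ Λ
    · obtain ⟨ν₀, hν₀⟩ := hk
      refine ⟨Int.fract (N * ν₀), ⟨Int.fract_nonneg _, Int.fract_lt_one _⟩, fun ν hν => ?_⟩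
      obtain ⟨m, hm⟩ := h.column_congruent (Set.mem_image_of_mem _ hν₀)
        (Set.mem_image_of_mem _ hν) (hcell0 _) (hcell0 _)
      refine ⟨⌊N * ν₀⌋ + m, ?_⟩
      push_cast
      linarith [Int.floor_add_fract (N * ν₀)]
    · exact ⟨0, by simp, fun ν hν => absurd ⟨ν, hν⟩ hk⟩
  choose a ha hal using hoff
  refine ⟨p₀.1, {k | ∃ ν, (p₀.1 + (k : ℝ) / 2, ν) ∈ Λ},
    fun k => {l | (p₀.1 + (k : ℝ) / 2, ((l : ℝ) + a k) / N) ∈ Λ}, a, hp₀0, ?_, ha, ?_, ?_, ?_⟩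
  · ext ⟨t, ν⟩
    simp only [Set.mem_iUnion, Set.mem_prod, Set.mem_singleton_iff, Set.mem_ofPred_eq,
      Set.mem_image, exists_prop]
    constructor
    · intro hp
      obtain ⟨k, hk⟩ := h.times_congruent _ (Set.mem_image_of_mem _ hp₀) _
        (Set.mem_image_of_mem _ hp)
      simp only at hk
      obtain rfl : t = p₀.1 + (k : ℝ) / 2 := by linarith
      obtain ⟨l, hl⟩ := hal k ν hp
      have hν : ((l : ℝ) + a k) / N = ν := by rw [← hl, mul_div_cancel_left₀ _ hN']
      exact ⟨k, ⟨ν, hp⟩, rfl, l, by rwa [hν], hν⟩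
    · rintro ⟨k, -, rfl, l, hl, rfl⟩
      exact hl
  · refine Set.eq_univ_of_forall fun k => ?_
    obtain ⟨_, ⟨p, hp, rfl⟩, hx, -⟩ := h.cover (2 * p₀.1 + k) 0
    obtain ⟨m, hm⟩ := h.times_congruent _ (Set.mem_image_of_mem _ hp₀) _
      (Set.mem_image_of_mem _ hp)
    simp only at hm hx
    rcases hx.eq_of_int (m := k - m) (by push_cast; linarith) with e | e
    · left
      refine ⟨p.2, ?_⟩
      have : p.1 = p₀.1 + (k : ℝ) / 2 := by linarith
      rwa [← this]
    · right
      refine ⟨k - N, ⟨p.2, ?_⟩, by simp⟩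
      have : p.1 = p₀.1 + ((k - N : ℤ) : ℝ) / 2 := by push_cast; linarith
      rwa [← this]
  · rw [Set.disjoint_left]
    rintro _ ⟨ν, hν⟩ ⟨k, ⟨ν', hν'⟩, rfl⟩
    refine h.time_sub_ne (Set.mem_image_of_mem _ hν') (Set.mem_image_of_mem _ hν) ?_
    push_cast
    ring
  · rintro k ⟨ν₀, hν₀⟩ z
    have hmem : ∀ l' : ℤ, (p₀.1 + (k : ℝ) / 2, ((l' : ℝ) + a k) / N) ∈ Λ →
        (2 * (p₀.1 + (k : ℝ) / 2), (l' : ℝ) + a k) ∈ scaleSet N Λ := by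
      intro l' hl'
      have := (mem_scaleSet_iff hN).2 hl'
      rwa [mul_div_cancel₀ _ hN'] at this
    -- Existence of the decomposition of `z` comes from covering the height `z + a k` at this time,
    -- uniqueness from packing.
    obtain ⟨_, ⟨⟨t, ν⟩, hp, rfl⟩, ht, hy⟩ :=
      h.exists_at_time (Set.mem_image_of_mem _ hν₀) (z + a k)
    simp only at ht hy
    obtain rfl : t = p₀.1 + (k : ℝ) / 2 := by linarith
    obtain ⟨l, hl⟩ := hal k ν hp
    have hν : ((l : ℝ) + a k) / N = ν := by rw [← hl, mul_div_cancel_left₀ _ hN']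
    have hlΛ : (p₀.1 + (k : ℝ) / 2, ((l : ℝ) + a k) / N) ∈ Λ := by rwa [hν]
    rw [hl] at hy
    obtain ⟨j, hj, e⟩ := hy.eq_of_int (m := z - l) (by push_cast; ring)
    refine ⟨l, hlΛ, j, hj, ?_, ?_⟩
    · have : (l + 2 * j : ℝ) = z := by linarith
      exact_mod_cast this
    · intro l' hl' j' hj' e'
      have e'' : (l' : ℝ) + 2 * j' = z := by exact_mod_cast e'
      have := h.packing (hmem l' hl') (hmem l hlΛ) (hcell0 _)
        ⟨j', hj', by simp only; linarith, by simp only; linarith⟩ (hcell0 _) hy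
      have := congrArg Prod.snd this
      simp only [add_left_inj, Int.cast_inj] at this
      exact this

end Structure

theorem mainTheorem4 (α β : ℝ) (hα : α = 1 / 2) (hβ : 0 < β) (n : ℕ) (hn : β = (n : ℝ) / 2)
    (Λ : Set (ℝ × ℝ)) (hΛ : IsGaborONB (charFn (twoIntervals α β)) Λ) :
    IsStandard (twoIntervals α β) Λ ∧
    ∃ (s : ℝ) (K : Set ℤ) (L : ℤ → Set ℤ) (a : ℤ → ℝ),
      ((0, 0) ∈ Λ → s = 0) ∧
      Λ = ⋃ k ∈ K, ({s + (k : ℝ) / 2} : Set ℝ) ×ˢ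
        ((fun l : ℤ => ((l : ℝ) + a k) / (2 * β + 1)) '' L k) ∧
      (∀ k ∈ K, a k ∈ Set.Ico (0 : ℝ) 1) ∧
      K ∪ (fun k : ℤ => ((n : ℤ) + 1) + k) '' K = Set.univ ∧
      Disjoint K ((fun k : ℤ => ((n : ℤ) + 1) + k) '' K) ∧
      (∀ k ∈ K, L k + {m : ℤ | ∃ j : ℤ, |j| ≤ (n : ℤ) ∧ m = 2 * j} = Set.univ) ∧
      (∀ k ∈ K, TilesInt (L k) {m : ℤ | ∃ j : ℤ, 0 ≤ j ∧ j ≤ (n : ℤ) ∧ m = 2 * j}) := by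
  have hn0 : 0 < n := by
    rw [hn] at hβ
    have : (0 : ℝ) < n := by linarith
    exact_mod_cast this
  rw [twoIntervals_half hα hn] at hΛ ⊢
  have h := scaledTiling_of_isGaborONB (by omega) hΛ
  refine ⟨isStandard_of_scaledTiling h hΛ, ?_⟩
  have hNβ : 2 * β + 1 = ((n + 1 : ℕ) : ℝ) := by rw [hn]; push_cast; ring
  obtain ⟨s, K, L, a, hs, hΛeq, ha, hK, hKd, hL⟩ := exists_lattice_structure h
  refine ⟨s, K, L, a, hs, ?_, fun k _ => ha k, ?_, ?_, fun k hk => ?_, fun k hk z => ?_⟩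
  · rw [hNβ]
    exact hΛeq
  · simpa using hK
  · simpa using hKd
  · refine Set.eq_univ_of_forall fun z => ?_
    obtain ⟨l, hl, j, hj, e, -⟩ := hL k hk z
    -- The range `0 ≤ j ≤ n` lies in `|j| ≤ n`, so the symmetric sum needs only existence.
    exact Set.mem_add.2 ⟨l, hl, 2 * j, ⟨j, by rw [Nat.abs_cast]; omega, rfl⟩, e⟩
  · obtain ⟨l, hl, j, hj, e, hu⟩ := hL k hk z
    refine ⟨(l, 2 * j), ⟨hl, ⟨j, by omega, by omega, rfl⟩, e⟩, ?_⟩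
    rintro ⟨l', m'⟩ ⟨hl', ⟨j', hj0, hjn, rfl⟩, e'⟩
    simp only at hl' e'
    obtain ⟨i, rfl⟩ := Int.eq_ofNat_of_zero_le hj0
    obtain rfl := hu l' hl' i (by omega) e'
    refine Prod.ext rfl ?_
    simp only
    omega
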